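/- For real $x\ge 1$ put $m(x)=\sum_{n\le x}\mu(n)/n$, where $\mu$ is the Möbius function, and let $\zeta$ be the Riemann zeta function. (1) If $\rho$ is a zero of $\zeta$, then for all $x\ge 1$ $$\int_1^x |m(t)|\,dt \;\ge\; \Bigl(1+\frac{|\rho-1|\,|\rho|}{|\operatorname{Re}\rho|}\Bigr)^{-1}\bigl(x^{\operatorname{Re}\rho}-1/x\bigr)$$ (note that $\zeta$ has no zero with real part $0$). (2) For all $x\ge 1$, $\displaystyle\int_1^x |m(t)|\,dt \ge 0.0025\,(\sqrt x-1/x)$. (3) If $\rho$ is a zero of $\zeta$ with $\operatorname{Re}\rho=1$ and if, for some $\varepsilon>0$, $|m(x)|\le\varepsilon+o(1)$ as $x\to\infty$ (in particular if $|m(x)|=\varepsilon+o(1)$), then $|\operatorname{Im}\rho|\ge 1/\sqrt\varepsilon-1$. (4) If $m(x)=o(1)$ as $x\to\infty$, then $\zeta(s)\ne 0$ for all $s$ with $\operatorname{Re}s=1$. (5) For all real $t\neq 0$ and all $x\ge 1$, $$\Bigl|\sum_{n\le x}\frac{\mu(n)}{n^{1+it}}-\frac1{\zeta(1+it)}\Bigr|\le\frac{2+t^2}{|\zeta(1+it)|}\,\frac1x\int_1^x|m(u)|\,du+|m(x)|+\frac{1}{|\zeta(1+it)|\,x^2},$$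 and if moreover $x\ge 2$, then also $$\Bigl|\sum_{n\le x}\frac{\mu(n)}{n^{1+it}}-\frac1{\zeta(1+it)}\Bigr|\le\frac{2+t^2}{|\zeta(1+it)|}\,\frac1x\int_1^x|m(u)|\,du+|m(x)|+\frac{1}{x^2}.$$ -/

import Mathlib

noncomputable section

/-- The summatory function `m(x) = ∑_{1 ≤ n ≤ x} μ(n)/n` of the Möbius function. -/
def mobM (x : ℝ) : ℝ :=
  ∑ n ∈ Finset.Icc 1 ⌊x⌋₊, (ArithmeticFunction.moebius n : ℝ) / (n : ℝ)

/-- The partial sums `∑_{1 ≤ n ≤ x} μ(n)/n^s`, for complex `s`. -/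
def mobDirichlet (s : ℂ) (x : ℝ) : ℂ :=
  ∑ n ∈ Finset.Icc 1 ⌊x⌋₊, (ArithmeticFunction.moebius n : ℂ) / (n : ℂ) ^ s

end

open Set MeasureTheory Filter Topology

/-! Everything rests on one convolution identity. For `s ≠ 1` put K(y) = (s-1) y^s ∑_{k≤y} k^(-s) +
N(N+1)/y with N = ⌊y⌋. Then ∫_1^x m(t) K(x/t) dt = x^s - 1/x (`integral_mobM_mul_mobKernel`). Indeed
N(N+1) = ∑_{k≤N} 2k, so both parts of K(x/t) are sums over the k with t ≤ x/k. For fixed n and k,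
integrating over n ≤ t ≤ x/k gives n((x/(nk))^s - nk/x), because the two terms x/k cancel; Möbius
inversion over nk ≤ x then leaves only nk = 1.

On the other side, Euler–Maclaurin gives K(y) = (s-1) ζ(s) y^s + O(1) for Re s > 0, with an explicit
constant C (`norm_mobKernel_sub_le`): the pole term contributes -y and N(N+1)/y restores it. The
power y^s also integrates exactly against m, giving x^s ∑_{n≤x} μ(n)/n^s - x m(x). Comparing the
two, `norm_cpow_sub_sub_le` bounds x^s - 1/x - ζ(s)(x^s ∑_{n≤x} μ(n)/n^s - x m(x)) by C ∫_1^x |m|.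

At a zero ρ the ζ term disappears, which gives (1). Zeros with Re ρ ≤ -1 make the bound trivial and
there are none with -1 < Re ρ ≤ 0. For Re ρ = 1, letting x tend to infinity gives 1 ≤ Cε, hence (3),
and (4) follows with ε small. On Re s = 1, dividing by ζ(s) x^s gives (5).

For (2) a zero with real part at least 1/2 and small height is needed. Order-six Euler–Maclaurin
with cutoff 5 approximates ζ near 1/2 + 14.135i; the approximation is tiny at the centre and bounded
below on a circle of radius 0.2, so the minimum modulus principle yields a zero inside, reflected by
s ↦ 1 - s if it lies left of the critical line. -/

/-! ### Representation of ζ and its partial sums on Re s > 0 by the fractional part. -/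

theorem integrableOn_Ioi_mul_cpow {P : ℝ → ℂ} (hP : Measurable P) {C : ℝ} (hC : ∀ u, ‖P u‖ ≤ C)
    {y : ℝ} (hy : 0 < y) {a : ℂ} (ha : a.re < -1) :
    IntegrableOn (fun u : ℝ => P u * (u : ℂ) ^ a) (Ioi y) :=
  (integrableOn_Ioi_cpow_of_lt ha hy).bdd_mul hP.aestronglyMeasurable
    (Eventually.of_forall hC)

theorem norm_integral_Ioi_mul_cpow_le {P : ℝ → ℂ} {C : ℝ}
    {y : ℝ} (hC : ∀ u, y < u → ‖P u‖ ≤ C) (hy : 0 < y) {a : ℂ} (ha : a.re < -1) :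
    ‖∫ u in Ioi y, P u * (u : ℂ) ^ a‖ ≤ C * (y ^ (a.re + 1) / (-(a.re + 1))) := by
  have h : ∫ u in Ioi y, C * u ^ a.re = C * (y ^ (a.re + 1) / (-(a.re + 1))) := by
    rw [integral_const_mul, integral_Ioi_rpow_of_lt ha hy, neg_div, ← div_neg]
  rw [← h]
  refine norm_integral_le_of_norm_le ((integrableOn_Ioi_rpow_of_lt ha hy).const_mul C) ?_
  filter_upwards [ae_restrict_mem measurableSet_Ioi] with u hu
  rw [norm_mul, Complex.norm_cpow_eq_rpow_re_of_pos (hy.trans hu)]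
  exact mul_le_mul_of_nonneg_right (hC u hu) (Real.rpow_nonneg (hy.trans hu).le _)

theorem norm_ofReal_fract_le (u : ℝ) : ‖((Int.fract u : ℝ) : ℂ)‖ ≤ 1 := by
  rw [Complex.norm_real, Real.norm_eq_abs, abs_of_nonneg (Int.fract_nonneg u)]
  exact (Int.fract_lt_one u).le

theorem measurable_ofReal_fract : Measurable (fun u : ℝ => ((Int.fract u : ℝ) : ℂ)) :=
  Complex.measurable_ofReal.comp measurable_fract

theorem ofReal_natFloor_eq {u : ℝ} (hu : 0 ≤ u) :
    ((⌊u⌋₊ : ℕ) : ℂ) = (u : ℂ) - ((Int.fract u : ℝ) : ℂ) := by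
  rw [← Complex.ofReal_natCast, natCast_floor_eq_intCast_floor hu, ← Complex.ofReal_sub,
    Int.self_sub_fract]

theorem riemannZeta_eq_integral_fract_of_one_lt {s : ℂ} (hs : 1 < s.re) :
    riemannZeta s = s / (s - 1) -
      s * ∫ u in Ioi (1 : ℝ), ((Int.fract u : ℝ) : ℂ) * (u : ℂ) ^ (-(s + 1)) := by
  have hs1 : s - 1 ≠ 0 := by
    intro h; rw [sub_eq_zero.1 h] at hs; simp at hs
  have h1 : riemannZeta s = LSeries (fun _ => 1) s := (LSeries_one_eq_riemannZeta hs).symm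
  rw [h1, LSeries_eq_mul_integral' (fun _ => (1 : ℂ)) zero_le_one hs
    (by simpa using Asymptotics.isBigO_refl _ _)]
  have h2 : ∫ u in Ioi (1 : ℝ), (u : ℂ) ^ (-s) = 1 / (s - 1) := by
    rw [integral_Ioi_cpow_of_lt (by simpa using hs) one_pos]
    simp only [Complex.ofReal_one, Complex.one_cpow]
    rw [show (-s + 1) = -(s - 1) by ring, div_neg, neg_div, neg_neg]
  have h3 : ∫ u in Ioi (1 : ℝ), (∑ k ∈ Finset.Icc 1 ⌊u⌋₊, (1 : ℂ)) * (u : ℂ) ^ (-(s + 1)) =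
      ∫ u in Ioi (1 : ℝ), ((u : ℂ) ^ (-s) - ((Int.fract u : ℝ) : ℂ) * (u : ℂ) ^ (-(s + 1))) := by
    refine setIntegral_congr_fun measurableSet_Ioi fun u hu => ?_
    have hu0 : (0 : ℝ) < u := one_pos.trans hu
    have hu' : (u : ℂ) ≠ 0 := by exact_mod_cast hu0.ne'
    have h4 : (u : ℂ) ^ (-s) = u * (u : ℂ) ^ (-(s + 1)) := by
      rw [show -s = 1 + -(s + 1) by ring, Complex.cpow_add _ _ hu', Complex.cpow_one]
    simp only [Finset.sum_const, Nat.card_Icc, Nat.add_sub_cancel, nsmul_eq_mul, mul_one]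
    rw [ofReal_natFloor_eq hu0.le, h4]; ring
  rw [h3, integral_sub (integrableOn_Ioi_cpow_of_lt (by simpa using hs) one_pos)
    (integrableOn_Ioi_mul_cpow measurable_ofReal_fract norm_ofReal_fract_le one_pos
      (by simp; linarith)), h2]
  ring

/-- The integral is the Mellin transform, at -s, of the fractional part cut off to u > 1. -/
theorem differentiableAt_integral_fract {s : ℂ} (hs : 0 < s.re) :
    DifferentiableAt ℂ
      (fun s : ℂ => ∫ u in Ioi (1 : ℝ), ((Int.fract u : ℝ) : ℂ) * (u : ℂ) ^ (-(s + 1))) s := by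
  set f : ℝ → ℂ := (Ioi (1 : ℝ)).indicator (fun u => ((Int.fract u : ℝ) : ℂ)) with hf
  have hfm : Measurable f := measurable_ofReal_fract.indicator measurableSet_Ioi
  have hfb : ∀ u, ‖f u‖ ≤ 1 := fun u =>
    (norm_indicator_le_norm_self _ _).trans (norm_ofReal_fract_le u)
  have h1 : (fun s : ℂ => ∫ u in Ioi (1 : ℝ), ((Int.fract u : ℝ) : ℂ) * (u : ℂ) ^ (-(s + 1))) =
      fun s => mellin f (-s) := by
    ext s
    rw [mellin]
    have : ∀ u : ℝ, (u : ℂ) ^ (-s - 1) • f u = (Ioi (1 : ℝ)).indicator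
        (fun u : ℝ => ((Int.fract u : ℝ) : ℂ) * (u : ℂ) ^ (-(s + 1))) u := by
      intro u
      rw [hf, show -s - 1 = -(s + 1) by ring]
      by_cases hu : u ∈ Ioi (1 : ℝ) <;> simp [indicator, hu, mul_comm]
    simp_rw [this]
    rw [setIntegral_indicator measurableSet_Ioi, Ioi_inter_Ioi, sup_eq_right.2 zero_le_one]
  rw [h1]
  have h2 : DifferentiableAt ℂ (mellin f) (-s) := by
    -- The cut-off function vanishes near 0, so any exponent `b` below -Re s is admissible there;
    -- boundedness at infinity allows `a = 0`.
    refine mellin_differentiableAt_of_isBigO_rpow (a := 0) (b := -s.re - 1) ?_ ?_ (by simpa) ?_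
      (by simp)
    · refine LocallyIntegrable.locallyIntegrableOn ?_ _
      refine (locallyIntegrable_const (1 : ℝ)).mono hfm.aestronglyMeasurable ?_
      exact Eventually.of_forall fun u => by simpa using hfb u
    · refine Asymptotics.IsBigO.of_bound 1 (Eventually.of_forall fun u => ?_)
      simpa using hfb u
    · refine Asymptotics.IsBigO.of_bound 1 ?_
      have : Iio (1 : ℝ) ∈ 𝓝[>] (0 : ℝ) := mem_nhdsWithin_of_mem_nhds (Iio_mem_nhds one_pos)
      filter_upwards [this] with u hu
      have : u ∉ Ioi (1 : ℝ) := by simpa using (le_of_lt hu)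
      rw [hf, indicator_of_notMem this]
      simp only [norm_zero]; positivity
  exact DifferentiableAt.comp (g := mellin f) (f := fun z : ℂ => -z) s h2 (by fun_prop)

theorem riemannZeta_eq_integral_fract {s : ℂ} (hs : 0 < s.re) (hs1 : s ≠ 1) :
    riemannZeta s = s / (s - 1) -
      s * ∫ u in Ioi (1 : ℝ), ((Int.fract u : ℝ) : ℂ) * (u : ℂ) ^ (-(s + 1)) := by
  set J : ℂ → ℂ := fun s => ∫ u in Ioi (1 : ℝ), ((Int.fract u : ℝ) : ℂ) * (u : ℂ) ^ (-(s + 1))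
  have hopen : IsOpen {s : ℂ | 0 < s.re} := isOpen_lt continuous_const Complex.continuous_re
  -- The pole is removed first: both sides multiplied by s - 1 are holomorphic on the whole
  -- half-plane, so the identity theorem propagates the case Re s > 1.
  have key : EqOn riemannZeta₁ (fun s => s - s * (s - 1) * J s) {s : ℂ | 0 < s.re} := by
    refine AnalyticOnNhd.eqOn_of_preconnected_of_eventuallyEq (𝕜 := ℂ) (z₀ := 2) ?_ ?_ ?_ ?_ ?_
    · exact differentiable_riemannZeta₁.differentiableOn.analyticOnNhd hopen
    · refine DifferentiableOn.analyticOnNhd (fun z hz => ?_) hopen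
      have : DifferentiableAt ℂ J z := differentiableAt_integral_fract hz
      exact DifferentiableAt.differentiableWithinAt (by fun_prop)
    · exact (convex_halfSpace_re_gt 0).isPreconnected
    · simp
    · have : {z : ℂ | 1 < z.re} ∈ 𝓝 (2 : ℂ) :=
        (isOpen_lt continuous_const Complex.continuous_re).mem_nhds (by simp)
      filter_upwards [this] with z hz
      have hz1 : z - 1 ≠ 0 := by
        intro h; rw [sub_eq_zero.1 h] at hz; simp at hz
      have h1 := riemannZeta_eq_integral_fract_of_one_lt hz
      rw [riemannZeta_eq_inv_sub_mul (sub_ne_zero.1 hz1)] at h1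
      have h2 : riemannZeta₁ z = (z - 1) * ((z - 1)⁻¹ * riemannZeta₁ z) := by
        field_simp
      rw [h2, h1]
      simp only [J]
      field_simp
  have hs2 : s - 1 ≠ 0 := sub_ne_zero.2 hs1
  rw [riemannZeta_eq_inv_sub_mul hs1, key hs]
  simp only [J]
  field_simp

theorem sum_cpow_eq_sub_integral_fract (s : ℂ) (hs0 : s ≠ 0) (hs1 : s ≠ 1) {y : ℝ} (hy : 1 ≤ y) :
    ∑ k ∈ Finset.Icc 1 ⌊y⌋₊, (k : ℂ) ^ (-s) = s / (s - 1) + (y : ℂ) ^ (1 - s) / (1 - s) -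
      Int.fract y * (y : ℂ) ^ (-s) -
      s * ∫ u in Ioc 1 y, ((Int.fract u : ℝ) : ℂ) * (u : ℂ) ^ (-(s + 1)) := by
  have hy0 : 0 < y := one_pos.trans_le hy
  have hyc : (y : ℂ) ≠ 0 := by exact_mod_cast hy0.ne'
  have hs2 : s - 1 ≠ 0 := sub_ne_zero.2 hs1
  have hs3 : 1 - s ≠ 0 := sub_ne_zero.2 (Ne.symm hs1)
  -- Weight 0 at k = 0, so that Abel summation, which starts at 0, yields the sum from 1.
  set c : ℕ → ℂ := fun k => if k = 0 then 0 else 1 with hc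
  have hpos : ∀ u ∈ Icc 1 y, u ≠ 0 := fun u hu => (one_pos.trans_le hu.1).ne'
  have hderiv : ∀ u ∈ Icc 1 y, deriv (fun x : ℝ => (x : ℂ) ^ (-s)) u = -s * (u : ℂ) ^ (-s - 1) :=
    fun u hu => Complex.deriv_ofReal_cpow_const (hpos u hu) (neg_ne_zero.2 hs0)
  have hcont : ∀ a : ℂ, ContinuousOn (fun u : ℝ => (u : ℂ) ^ a) (Icc 1 y) := fun a u hu =>
    (Complex.continuousAt_ofReal_cpow_const u a (Or.inr (hpos u hu))).continuousWithinAt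
  have hsum : ∀ n : ℕ, ∑ k ∈ Finset.Icc 0 n, c k = n := fun n => by
    rw [← Finset.insert_Icc_add_one_left_eq_Icc n.zero_le, Finset.sum_insert (by simp)]
    rw [Finset.sum_congr rfl (g := fun _ => (1 : ℂ)) (fun k hk => ?_)]
    · simp [hc]
    · simp only [zero_add, Finset.mem_Icc] at hk
      simp [hc]; omega
  have hab := sum_mul_eq_sub_integral_mul₀ (f := fun x : ℝ => (x : ℂ) ^ (-s)) c (by simp [hc]) y
    (fun t ht => differentiableAt_id.ofReal_cpow_const (hpos t ht) (neg_ne_zero.2 hs0))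
    (((hcont (-s - 1)).const_mul (-s)).congr hderiv |>.integrableOn_Icc)
  have hL : ∑ k ∈ Finset.Icc 0 ⌊y⌋₊, (((k : ℕ) : ℝ) : ℂ) ^ (-s) * c k =
      ∑ k ∈ Finset.Icc 1 ⌊y⌋₊, (k : ℂ) ^ (-s) := by
    rw [← Finset.insert_Icc_add_one_left_eq_Icc ⌊y⌋₊.zero_le, Finset.sum_insert (by simp)]
    simp only [hc, if_true, mul_zero, zero_add]
    refine Finset.sum_congr rfl fun k hk => ?_
    have : k ≠ 0 := by have := (Finset.mem_Icc.1 hk).1; omega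
    simp [this]
  have hI : ∫ t in Ioc 1 y, deriv (fun x : ℝ => (x : ℂ) ^ (-s)) t *
        ∑ k ∈ Finset.Icc 0 ⌊t⌋₊, c k =
      ∫ t in Ioc 1 y, ((-s) * (t : ℂ) ^ (-s) + s *
        (((Int.fract t : ℝ) : ℂ) * (t : ℂ) ^ (-(s + 1)))) := by
    refine setIntegral_congr_fun measurableSet_Ioc fun t ht => ?_
    have ht0 : 0 < t := one_pos.trans ht.1
    have htc : (t : ℂ) ≠ 0 := by exact_mod_cast ht0.ne'
    have h4 : (t : ℂ) ^ (-s) = t * (t : ℂ) ^ (-(s + 1)) := by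
      rw [show -s = 1 + -(s + 1) by ring, Complex.cpow_add _ _ htc, Complex.cpow_one]
    rw [hderiv t ⟨ht.1.le, ht.2⟩, hsum, ofReal_natFloor_eq ht0.le, h4,
      show -s - 1 = -(s + 1) by ring]
    ring
  have hint1 : IntegrableOn (fun t : ℝ => (t : ℂ) ^ (-s)) (Ioc 1 y) :=
    (hcont _).integrableOn_Icc.mono_set Ioc_subset_Icc_self
  have hint2 : IntegrableOn (fun t : ℝ => ((Int.fract t : ℝ) : ℂ) * (t : ℂ) ^ (-(s + 1)))
      (Ioc 1 y) :=
    ((hcont _).integrableOn_Icc.mono_set Ioc_subset_Icc_self).bdd_mul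
      measurable_ofReal_fract.aestronglyMeasurable (Eventually.of_forall norm_ofReal_fract_le)
  have hJ : ∫ t in Ioc 1 y, (t : ℂ) ^ (-s) = ((y : ℂ) ^ (1 - s) - 1) / (1 - s) := by
    rw [← intervalIntegral.integral_of_le hy, integral_cpow]
    · simp [show -s + 1 = 1 - s by ring]
    · right
      refine ⟨fun h => hs1 (neg_injective h), ?_⟩
      rw [uIcc_of_le hy]; simp
  rw [hL, hI, hsum, integral_add (hint1.const_mul _) (hint2.const_mul _), integral_const_mul,
    integral_const_mul, hJ, ofReal_natFloor_eq hy0.le] at hab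
  have h5 : (y : ℂ) ^ (1 - s) = y * (y : ℂ) ^ (-s) := by
    rw [show 1 - s = 1 + -s by ring, Complex.cpow_add _ _ hyc, Complex.cpow_one]
  rw [hab, h5, show s - 1 = -(1 - s) by ring]
  field_simp
  ring

theorem sum_cpow_eq_riemannZeta_add {s : ℂ} (hs : 0 < s.re) (hs1 : s ≠ 1) {y : ℝ} (hy : 1 ≤ y) :
    ∑ k ∈ Finset.Icc 1 ⌊y⌋₊, (k : ℂ) ^ (-s) = riemannZeta s + (y : ℂ) ^ (1 - s) / (1 - s) -
      Int.fract y * (y : ℂ) ^ (-s) +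
      s * ∫ u in Ioi y, ((Int.fract u : ℝ) : ℂ) * (u : ℂ) ^ (-(s + 1)) := by
  have hs0 : s ≠ 0 := by rintro rfl; simp at hs
  have hint : ∀ {z : ℝ}, 0 < z → IntegrableOn
      (fun u : ℝ => ((Int.fract u : ℝ) : ℂ) * (u : ℂ) ^ (-(s + 1))) (Ioi z) := fun hz =>
    integrableOn_Ioi_mul_cpow measurable_ofReal_fract norm_ofReal_fract_le hz (by simp; linarith)
  have hsplit : ∫ u in Ioi (1 : ℝ), ((Int.fract u : ℝ) : ℂ) * (u : ℂ) ^ (-(s + 1)) =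
      (∫ u in Ioc 1 y, ((Int.fract u : ℝ) : ℂ) * (u : ℂ) ^ (-(s + 1))) +
      ∫ u in Ioi y, ((Int.fract u : ℝ) : ℂ) * (u : ℂ) ^ (-(s + 1)) := by
    rw [← setIntegral_union (Ioc_disjoint_Ioi le_rfl) measurableSet_Ioi
      ((hint one_pos).mono_set Ioc_subset_Ioi_self) (hint (one_pos.trans_le hy)),
      Ioc_union_Ioi_eq_Ioi hy]
  rw [sum_cpow_eq_sub_integral_fract s hs0 hs1 hy, riemannZeta_eq_integral_fract hs hs1, hsplit]
  ring

/-! ### Size of the kernel. -/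

/-- The kernel against which `mobM` integrates to `x ^ s - 1 / x`. -/
noncomputable def mobKernel (s : ℂ) (y : ℝ) : ℂ :=
  (s - 1) * ((y : ℂ) ^ s * ∑ k ∈ Finset.Icc 1 ⌊y⌋₊, (k : ℂ) ^ (-s)) +
    (⌊y⌋₊ : ℂ) * ((⌊y⌋₊ : ℂ) + 1) / y

theorem abs_floor_mul_floor_add_one_div_sub_le {y : ℝ} (hy : 1 ≤ y) :
    |(⌊y⌋₊ : ℝ) * ((⌊y⌋₊ : ℝ) + 1) / y - y| ≤ 1 := by
  have hy0 : 0 < y := one_pos.trans_le hy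
  have h1 := Nat.floor_le hy0.le
  have h2 := Nat.lt_floor_add_one y
  rw [abs_le, le_sub_iff_add_le, sub_le_iff_le_add, le_div_iff₀ hy0, div_le_iff₀ hy0]
  constructor <;> nlinarith

/-- Replacing {u} by {u} - c in the tail integral changes it by an explicit term, which turns the
boundary value {y} into {y} - c. The free shift c balances the boundary error `d` against the tail
error `K`; the leading 1 comes from ⌊y⌋(⌊y⌋+1)/y - y. -/
theorem norm_mobKernel_sub_le {s : ℂ} (hs : 0 < s.re) (hs1 : s ≠ 1) {y : ℝ} (hy : 1 ≤ y)
    {c d K : ℝ} (hd : |Int.fract y - c| ≤ d) (hK : ∀ u : ℝ, |Int.fract u - c| ≤ K) :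
    ‖mobKernel s y - (s - 1) * riemannZeta s * (y : ℂ) ^ s‖ ≤
      1 + ‖s - 1‖ * (d + K * (‖s‖ / s.re)) := by
  have hy0 : 0 < y := one_pos.trans_le hy
  have hyc : (y : ℂ) ≠ 0 := by exact_mod_cast hy0.ne'
  have hs0 : s ≠ 0 := by rintro rfl; simp at hs
  have hs3 : 1 - s ≠ 0 := sub_ne_zero.2 (Ne.symm hs1)
  have hre : (-(s + 1)).re < -1 := by simp; linarith
  have hint : IntegrableOn (fun u : ℝ => (u : ℂ) ^ (-(s + 1))) (Ioi y) :=
    integrableOn_Ioi_cpow_of_lt hre hy0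
  have hintf : IntegrableOn (fun u : ℝ => ((Int.fract u : ℝ) : ℂ) * (u : ℂ) ^ (-(s + 1))) (Ioi y) :=
    integrableOn_Ioi_mul_cpow measurable_ofReal_fract norm_ofReal_fract_le hy0 hre
  set J := ∫ u in Ioi y, (((Int.fract u - c : ℝ) : ℝ) : ℂ) * (u : ℂ) ^ (-(s + 1)) with hJ
  have hJ' : ∫ u in Ioi y, ((Int.fract u : ℝ) : ℂ) * (u : ℂ) ^ (-(s + 1)) =
      J + c * ((y : ℂ) ^ (-s) / s) := by
    have h1 : ∫ u in Ioi y, (u : ℂ) ^ (-(s + 1)) = (y : ℂ) ^ (-s) / s := by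
      rw [integral_Ioi_cpow_of_lt hre hy0, show -(s + 1) + 1 = -s by ring, neg_div_neg_eq]
    rw [← h1, ← integral_const_mul, hJ, ← integral_add _ (hint.const_mul _)]
    · congr 1; ext u; push_cast; ring
    · exact IntegrableOn.congr_fun (hintf.sub (hint.const_mul (c : ℂ)))
        (fun u _ => by simp only [Pi.sub_apply]; push_cast; ring) measurableSet_Ioi
  have hJn : ‖J‖ ≤ K * (y ^ (-s.re) / s.re) := by
    have := norm_integral_Ioi_mul_cpow_le (P := fun u => ((Int.fract u - c : ℝ) : ℂ)) (C := K)
      (y := y) (fun u _ => by rw [Complex.norm_real]; exact hK u) hy0 hre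
    rwa [show (-(s + 1)).re + 1 = -s.re by simp, neg_neg] at this
  have hps : (y : ℂ) ^ s * (y : ℂ) ^ (-s) = 1 := by
    rw [← Complex.cpow_add _ _ hyc]; simp
  have hps1 : (y : ℂ) ^ s * (y : ℂ) ^ (1 - s) = y := by
    rw [← Complex.cpow_add _ _ hyc]; simp
  have key : mobKernel s y - (s - 1) * riemannZeta s * (y : ℂ) ^ s =
      (((⌊y⌋₊ : ℝ) * ((⌊y⌋₊ : ℝ) + 1) / y - y : ℝ) : ℂ) +
        (s - 1) * (-((Int.fract y - c : ℝ) : ℂ) + s * ((y : ℂ) ^ s * J)) := by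
    rw [mobKernel, sum_cpow_eq_riemannZeta_add hs hs1 hy, hJ']
    push_cast
    have e : (y : ℂ) ^ s * (riemannZeta s + (y : ℂ) ^ (1 - s) / (1 - s) -
        Int.fract y * (y : ℂ) ^ (-s) + s * (J + c * ((y : ℂ) ^ (-s) / s))) =
        riemannZeta s * (y : ℂ) ^ s + ((y : ℂ) ^ s * (y : ℂ) ^ (1 - s)) / (1 - s)
        - Int.fract y * ((y : ℂ) ^ s * (y : ℂ) ^ (-s)) + s * ((y : ℂ) ^ s * J) +
        c * ((y : ℂ) ^ s * (y : ℂ) ^ (-s)) := by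
      field_simp
      ring
    rw [e, hps, hps1]
    field_simp
    ring
  rw [key]
  refine (norm_add_le _ _).trans (add_le_add ?_ ?_)
  · rw [Complex.norm_real]; exact abs_floor_mul_floor_add_one_div_sub_le hy
  · rw [norm_mul]
    refine mul_le_mul_of_nonneg_left ((norm_add_le _ _).trans (add_le_add ?_ ?_)) (norm_nonneg _)
    · rw [norm_neg, Complex.norm_real]; exact hd
    · rw [norm_mul, norm_mul, Complex.norm_cpow_eq_rpow_re_of_pos hy0]
      have h1 : y ^ s.re * ‖J‖ ≤ K / s.re := by
        calc y ^ s.re * ‖J‖ ≤ y ^ s.re * (K * (y ^ (-s.re) / s.re)) := by gcongr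
          _ = K / s.re := by
            rw [Real.rpow_neg hy0.le]
            have := (Real.rpow_pos_of_pos hy0 s.re).ne'
            field_simp
      calc ‖s‖ * (y ^ s.re * ‖J‖) ≤ ‖s‖ * (K / s.re) := by gcongr
        _ = _ := by ring

/-! ### Exact integrals of m against the kernel and against powers. -/

theorem integral_Icc_mobM_mul {x : ℝ} (g : ℝ → ℂ) (hg : IntegrableOn g (Icc 1 x)) :
    ∫ t in Icc 1 x, (mobM t : ℂ) * g t =
      ∑ n ∈ Finset.Icc 1 ⌊x⌋₊, (ArithmeticFunction.moebius n : ℂ) / n *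
        ∫ t in Icc (n : ℝ) x, g t := by
  have h1 : ∫ t in Icc 1 x, (mobM t : ℂ) * g t = ∫ t in Icc 1 x, ∑ n ∈ Finset.Icc 1 ⌊x⌋₊,
      (ArithmeticFunction.moebius n : ℂ) / n * (Ici (n : ℝ)).indicator g t := by
    refine setIntegral_congr_fun measurableSet_Icc fun t ht => ?_
    have ht0 : 0 ≤ t := zero_le_one.trans ht.1
    simp only [mobM]
    push_cast
    rw [Finset.sum_mul]
    have hsub : Finset.Icc 1 ⌊t⌋₊ ⊆ Finset.Icc 1 ⌊x⌋₊ :=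
      Finset.Icc_subset_Icc_right (Nat.floor_mono ht.2)
    rw [← Finset.sum_subset_zero_on_sdiff hsub (f := fun n : ℕ =>
      (ArithmeticFunction.moebius n : ℂ) / n * g t)]
    · intro n hn
      simp only [Finset.mem_sdiff, Finset.mem_Icc, not_and, not_le] at hn
      have : t < n := (Nat.floor_lt ht0).1 (hn.2 hn.1.1)
      rw [indicator_of_notMem (by simpa using this), mul_zero]
    · intro n hn
      have : (n : ℝ) ≤ t := (Nat.le_floor_iff ht0).1 (Finset.mem_Icc.1 hn).2
      rw [indicator_of_mem (by simpa using this)]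
  rw [h1, integral_finsetSum]
  · refine Finset.sum_congr rfl fun n hn => ?_
    have hn1 : (1 : ℝ) ≤ n := by exact_mod_cast (Finset.mem_Icc.1 hn).1
    rw [integral_const_mul, setIntegral_indicator measurableSet_Ici]
    congr 3
    ext t
    simp only [mem_inter_iff, mem_Icc, mem_Ici]
    constructor
    · rintro ⟨h, h'⟩; exact ⟨h', h.2⟩
    · rintro ⟨h, h'⟩; exact ⟨⟨hn1.trans h, h'⟩, h⟩
  · intro n _
    exact (hg.indicator measurableSet_Ici).const_mul _

theorem integral_Icc_mul_cpow_neg {s : ℂ} (hs1 : s ≠ 1) {a b : ℝ} (ha : 0 < a) (hab : a ≤ b) :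
    ∫ t in Icc a b, (s - 1) * (t : ℂ) ^ (-s) = (a : ℂ) ^ (1 - s) - (b : ℂ) ^ (1 - s) := by
  have hs3 : 1 - s ≠ 0 := sub_ne_zero.2 (Ne.symm hs1)
  rw [integral_const_mul, integral_Icc_eq_integral_Ioc, ← intervalIntegral.integral_of_le hab,
    integral_cpow]
  · rw [show -s + 1 = 1 - s by ring]; field_simp; ring
  · right
    refine ⟨fun h => hs1 (neg_injective h), ?_⟩
    rw [uIcc_of_le hab]; exact fun h => ha.not_ge h.1

theorem integrableOn_Icc_cpow (a : ℂ) {b c : ℝ} (hb : 0 < b) :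
    IntegrableOn (fun t : ℝ => (t : ℂ) ^ a) (Icc b c) :=
  ContinuousOn.integrableOn_Icc fun u hu =>
    (Complex.continuousAt_ofReal_cpow_const u a (Or.inr (hb.trans_le hu.1).ne')).continuousWithinAt

/-- Group the pairs by l = nk and use that ∑_{n∣l} μ(n) vanishes unless l = 1. -/
theorem sum_mul_moebius_eq {M : ℕ} (hM : 1 ≤ M) (h : ℕ → ℂ) :
    ∑ n ∈ Finset.Icc 1 M, ∑ k ∈ Finset.Icc 1 M,
      (if n * k ≤ M then (ArithmeticFunction.moebius n : ℂ) * h (n * k) else 0) = h 1 := by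
  have h1 : ∀ l ∈ Finset.Icc 1 M, ∑ p ∈ Finset.Icc 1 M ×ˢ Finset.Icc 1 M,
      (if p.1 * p.2 = l then (ArithmeticFunction.moebius p.1 : ℂ) * h l else 0) =
      if l = 1 then h 1 else 0 := by
    intro l hl
    rw [Finset.mem_Icc] at hl
    rw [← Finset.sum_filter, ← Finset.sum_mul]
    have h2 : (Finset.Icc 1 M ×ˢ Finset.Icc 1 M).filter (fun p => p.1 * p.2 = l) =
        l.divisorsAntidiagonal := by
      ext ⟨n, k⟩
      simp only [Finset.mem_filter, Finset.mem_product, Finset.mem_Icc,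
        Nat.mem_divisorsAntidiagonal]
      constructor
      · rintro ⟨-, rfl⟩; exact ⟨rfl, by omega⟩
      · rintro ⟨rfl, h0⟩
        have hn : 0 < n := Nat.pos_of_ne_zero fun h => h0 (by simp [h])
        have hk : 0 < k := Nat.pos_of_ne_zero fun h => h0 (by simp [h])
        exact ⟨⟨⟨hn, (Nat.le_mul_of_pos_right n hk).trans hl.2⟩,
          ⟨hk, (Nat.le_mul_of_pos_left k hn).trans hl.2⟩⟩, rfl⟩
    rw [h2]
    have h3 : ∑ p ∈ l.divisorsAntidiagonal, (ArithmeticFunction.moebius p.1 : ℂ) =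
        if l = 1 then 1 else 0 := by
      have := congrArg (fun f : ArithmeticFunction ℤ => f l)
        ArithmeticFunction.moebius_mul_coe_zeta
      simp only [ArithmeticFunction.mul_apply, ArithmeticFunction.one_apply] at this
      have h4 : ∑ p ∈ l.divisorsAntidiagonal, (ArithmeticFunction.moebius p.1 : ℤ) =
          if l = 1 then 1 else 0 := by
        rw [← this]
        refine Finset.sum_congr rfl fun p hp => ?_
        have : p.2 ≠ 0 := fun h => by
          have := (Nat.mem_divisorsAntidiagonal.1 hp); simp [h] at this; omega
        simp [this]
      exact_mod_cast h4
    rw [h3]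
    split_ifs with h
    · simp [h]
    · simp
  rw [← Finset.sum_product']
  calc _ = ∑ p ∈ Finset.Icc 1 M ×ˢ Finset.Icc 1 M, ∑ l ∈ Finset.Icc 1 M,
        (if p.1 * p.2 = l then (ArithmeticFunction.moebius p.1 : ℂ) * h l else 0) := by
        refine Finset.sum_congr rfl fun p hp => ?_
        rw [Finset.mem_product, Finset.mem_Icc, Finset.mem_Icc] at hp
        rw [Finset.sum_ite_eq]
        have : 1 ≤ p.1 * p.2 := Nat.mul_pos hp.1.1 hp.2.1
        simp [Finset.mem_Icc, this]
    _ = _ := by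
        rw [Finset.sum_comm, Finset.sum_congr rfl h1, Finset.sum_ite_eq']
        simp [hM]

theorem sum_Icc_natCast_mul_two (N : ℕ) :
    ∑ k ∈ Finset.Icc 1 N, (2 * (k : ℂ)) = (N : ℂ) * (N + 1) := by
  induction N with
  | zero => simp
  | succ N ih => rw [Finset.sum_Icc_succ_top (by omega), ih]; push_cast; ring

/-- Since N(N+1) = ∑_{k≤N} 2k, both parts of the kernel run over the same k, and k ≤ x/t means t ≤
x/k. The range of summation no longer depends on t, so the integral can be taken term by term. -/
theorem mobKernel_div_eq_sum (s : ℂ) {x t : ℝ} (ht : 1 ≤ t) (htx : t ≤ x) :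
    mobKernel s (x / t) = ∑ k ∈ Finset.Icc 1 ⌊x⌋₊, (Iic (x / k)).indicator (fun t : ℝ =>
      (x : ℂ) ^ s * (k : ℂ) ^ (-s) * ((s - 1) * (t : ℂ) ^ (-s)) + 2 * k / x * t) t := by
  have ht0 : 0 < t := one_pos.trans_le ht
  have hx0 : 0 < x := ht0.trans_le htx
  have hxt : 0 ≤ x / t := by positivity
  have htc : (t : ℂ) ≠ 0 := by exact_mod_cast ht0.ne'
  have hxc : (x : ℂ) ≠ 0 := by exact_mod_cast hx0.ne'
  have hdiv : ((x / t : ℝ) : ℂ) ^ s = (x : ℂ) ^ s * (t : ℂ) ^ (-s) := by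
    rw [div_eq_mul_inv, Complex.ofReal_mul, Complex.mul_cpow_ofReal_nonneg hx0.le (by positivity),
      Complex.ofReal_inv, Complex.inv_cpow _ _ (by
        rw [Complex.arg_ofReal_of_nonneg ht0.le]; exact Real.pi_pos.ne), Complex.cpow_neg]
  have hsub : Finset.Icc 1 ⌊x / t⌋₊ ⊆ Finset.Icc 1 ⌊x⌋₊ :=
    Finset.Icc_subset_Icc_right (Nat.floor_mono (div_le_self hx0.le ht))
  rw [mobKernel, ← sum_Icc_natCast_mul_two, hdiv, Finset.mul_sum, Finset.mul_sum, Finset.sum_div,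
    ← Finset.sum_add_distrib]
  refine Finset.sum_subset_zero_on_sdiff hsub (fun k hk => ?_) (fun k hk => ?_)
  · simp only [Finset.mem_sdiff, Finset.mem_Icc, not_and, not_le] at hk
    have hk0 : (0 : ℝ) < k := by exact_mod_cast hk.1.1
    have h1 : x / t < k := (Nat.floor_lt hxt).1 (hk.2 hk.1.1)
    refine indicator_of_notMem (fun h => ?_) _
    rw [mem_Iic, le_div_iff₀ hk0] at h
    rw [div_lt_iff₀ ht0] at h1
    linarith
  · have hk0 : (0 : ℝ) < k := by exact_mod_cast (Finset.mem_Icc.1 hk).1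
    have h1 : (k : ℝ) ≤ x / t := (Nat.le_floor_iff hxt).1 (Finset.mem_Icc.1 hk).2
    rw [indicator_of_mem]
    · push_cast; field_simp
    · rw [le_div_iff₀ ht0] at h1
      rw [mem_Iic, le_div_iff₀ hk0]; linarith

theorem integrableOn_mobKernel_div (s : ℂ) (x : ℝ) :
    IntegrableOn (fun t => mobKernel s (x / t)) (Icc 1 x) := by
  refine IntegrableOn.congr_fun (f := fun t => ∑ k ∈ Finset.Icc 1 ⌊x⌋₊,
    (Iic (x / k)).indicator (fun t : ℝ => (x : ℂ) ^ s * (k : ℂ) ^ (-s) *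
      ((s - 1) * (t : ℂ) ^ (-s)) + 2 * k / x * t) t) ?_
    (fun t ht => (mobKernel_div_eq_sum s ht.1 ht.2).symm) measurableSet_Icc
  refine integrable_finsetSum _ fun k _ => Integrable.indicator ?_ measurableSet_Iic
  exact (((integrableOn_Icc_cpow _ one_pos).const_mul _).const_mul _).add
    ((Complex.continuous_ofReal.integrableOn_Icc).const_mul _)

theorem integral_mobM_mul_mobKernel {s : ℂ} (hs1 : s ≠ 1) {x : ℝ} (hx : 1 ≤ x) :
    ∫ t in Icc 1 x, (mobM t : ℂ) * mobKernel s (x / t) = (x : ℂ) ^ s - 1 / x := by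
  have hx0 : 0 < x := one_pos.trans_le hx
  have hxc : (x : ℂ) ≠ 0 := by exact_mod_cast hx0.ne'
  rw [integral_Icc_mobM_mul _ (integrableOn_mobKernel_div s x)]
  have hM : 1 ≤ ⌊x⌋₊ := (Nat.one_le_floor_iff _).2 hx
  -- The pair (n, k) will contribute μ(n) h(nk) with h(l) = (x/l)^s - l/x, and h(1) is the
  -- right-hand side.
  have := sum_mul_moebius_eq hM (fun l => (x : ℂ) ^ s * (l : ℂ) ^ (-s) - l / x)
  simp only [Nat.cast_one, Complex.one_cpow, mul_one] at this
  rw [← this]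
  refine Finset.sum_congr rfl fun n hn => ?_
  have hn0 : 0 < n := (Finset.mem_Icc.1 hn).1
  have hnr : (0 : ℝ) < n := by exact_mod_cast hn0
  have hn1 : (1 : ℝ) ≤ n := by exact_mod_cast hn0
  have hnc : (n : ℂ) ≠ 0 := by exact_mod_cast hn0.ne'
  have hint : ∀ k : ℕ, IntegrableOn (fun t : ℝ => (x : ℂ) ^ s * (k : ℂ) ^ (-s) *
      ((s - 1) * (t : ℂ) ^ (-s)) + 2 * k / x * t) (Icc (n : ℝ) x) := fun k =>
    (((integrableOn_Icc_cpow _ hnr).const_mul _).const_mul _).add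
      ((Complex.continuous_ofReal.integrableOn_Icc).const_mul _)
  rw [setIntegral_congr_fun measurableSet_Icc
    (fun t ht => mobKernel_div_eq_sum s (hn1.trans ht.1) ht.2), integral_finsetSum _
    fun k _ => (hint k).indicator measurableSet_Iic, Finset.mul_sum]
  refine Finset.sum_congr rfl fun k hk => ?_
  have hk0 : 0 < k := (Finset.mem_Icc.1 hk).1
  have hkr : (0 : ℝ) < k := by exact_mod_cast hk0
  have hk1 : (1 : ℝ) ≤ k := by exact_mod_cast hk0
  have hkc : (k : ℂ) ≠ 0 := by exact_mod_cast hk0.ne'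
  have hset : Icc (n : ℝ) x ∩ Iic (x / k) = Icc (n : ℝ) (x / k) := by
    ext t
    simp only [mem_inter_iff, mem_Icc, mem_Iic]
    have := div_le_self hx0.le hk1
    constructor
    · rintro ⟨h, h'⟩; exact ⟨h.1, h'⟩
    · rintro ⟨h, h'⟩; exact ⟨⟨h, h'.trans this⟩, h'⟩
  have hiff : n * k ≤ ⌊x⌋₊ ↔ (n : ℝ) ≤ x / k := by
    rw [Nat.le_floor_iff hx0.le, le_div_iff₀ hkr]; push_cast; rfl
  rw [setIntegral_indicator measurableSet_Iic, hset]
  split_ifs with hnk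
  · have hnk' := hiff.1 hnk
    have hxk : ((x / k : ℝ) : ℂ) ^ (1 - s) = x * (x : ℂ) ^ (-s) * ((k : ℂ) ^ s / k) := by
      rw [div_eq_mul_inv, Complex.ofReal_mul, Complex.mul_cpow_ofReal_nonneg hx0.le (by positivity),
        Complex.ofReal_inv, Complex.inv_cpow _ _ (by
          rw [Complex.arg_ofReal_of_nonneg hkr.le]; exact Real.pi_pos.ne), ← Complex.cpow_neg,
        show 1 - s = 1 + -s by ring, Complex.cpow_add _ _ hxc, Complex.cpow_one,
        Complex.ofReal_natCast, show -(1 + -s) = -1 + s by ring, Complex.cpow_add _ _ hkc,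
        Complex.cpow_neg_one]
      ring
    have hn' : (n : ℂ) ^ (1 - s) = n * (n : ℂ) ^ (-s) := by
      rw [show 1 - s = 1 + -s by ring, Complex.cpow_add _ _ hnc, Complex.cpow_one]
    have hxs : (x : ℂ) ^ s * (x : ℂ) ^ (-s) = 1 := by
      rw [← Complex.cpow_add _ _ hxc]; simp
    have hks : (k : ℂ) ^ s * (k : ℂ) ^ (-s) = 1 := by
      rw [← Complex.cpow_add _ _ hkc]; simp
    have hnkc : ((n * k : ℕ) : ℂ) ^ (-s) = (n : ℂ) ^ (-s) * (k : ℂ) ^ (-s) := by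
      push_cast
      exact_mod_cast Complex.mul_cpow_ofReal_nonneg hnr.le hkr.le (-s)
    have hid : ∫ t in Icc (n : ℝ) (x / k), (t : ℂ) = (((x / k) ^ 2 - n ^ 2) / 2 : ℝ) := by
      rw [integral_Icc_eq_integral_Ioc, ← intervalIntegral.integral_of_le hnk',
        intervalIntegral.integral_ofReal, integral_id]
    rw [integral_add (((integrableOn_Icc_cpow _ hnr).const_mul _).const_mul _)
      ((Complex.continuous_ofReal.integrableOn_Icc).const_mul _), 
      integral_const_mul ((x : ℂ) ^ s * (k : ℂ) ^ (-s)), integral_Icc_mul_cpow_neg hs1 hnr hnk',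
      integral_const_mul, hid, hxk, hnkc,
      Complex.ofReal_natCast, hn']
    have e1 : (x : ℂ) ^ s * (k : ℂ) ^ (-s) * (n * (n : ℂ) ^ (-s) -
        x * (x : ℂ) ^ (-s) * ((k : ℂ) ^ s / k)) =
        n * ((x : ℂ) ^ s * ((n : ℂ) ^ (-s) * (k : ℂ) ^ (-s))) -
        ((x : ℂ) ^ s * (x : ℂ) ^ (-s)) * ((k : ℂ) ^ s * (k : ℂ) ^ (-s)) * (x / k) := by ring
    rw [e1, hxs, hks]
    push_cast
    field_simp
    ring
  · rw [Icc_eq_empty (fun h => hnk (hiff.2 h))]; simp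

theorem integral_mobM_mul_cpow {s : ℂ} (hs1 : s ≠ 1) {x : ℝ} (hx : 1 ≤ x) :
    ∫ t in Icc 1 x, (mobM t : ℂ) * ((s - 1) * ((x / t : ℝ) : ℂ) ^ s) =
      (x : ℂ) ^ s * mobDirichlet s x - x * mobM x := by
  have hx0 : 0 < x := one_pos.trans_le hx
  have hxc : (x : ℂ) ≠ 0 := by exact_mod_cast hx0.ne'
  have hdiv : ∀ t ∈ Icc 1 x, (mobM t : ℂ) * ((s - 1) * ((x / t : ℝ) : ℂ) ^ s) =
      (mobM t : ℂ) * ((x : ℂ) ^ s * ((s - 1) * (t : ℂ) ^ (-s))) := by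
    intro t ht
    have ht0 : 0 < t := one_pos.trans_le ht.1
    rw [div_eq_mul_inv, Complex.ofReal_mul, Complex.mul_cpow_ofReal_nonneg hx0.le (by positivity),
      Complex.ofReal_inv, Complex.inv_cpow _ _ (by
        rw [Complex.arg_ofReal_of_nonneg ht0.le]; exact Real.pi_pos.ne), Complex.cpow_neg]
    ring
  rw [setIntegral_congr_fun measurableSet_Icc hdiv, integral_Icc_mobM_mul _
    (((integrableOn_Icc_cpow _ one_pos).const_mul _).const_mul _), mobDirichlet, mobM]
  push_cast
  rw [Finset.mul_sum, Finset.mul_sum, ← Finset.sum_sub_distrib]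
  refine Finset.sum_congr rfl fun n hn => ?_
  have hn0 : 0 < n := (Finset.mem_Icc.1 hn).1
  have hnr : (0 : ℝ) < n := by exact_mod_cast hn0
  have hnc : (n : ℂ) ≠ 0 := by exact_mod_cast hn0.ne'
  have hnx : (n : ℝ) ≤ x := (Nat.le_floor_iff hx0.le).1 (Finset.mem_Icc.1 hn).2
  rw [integral_const_mul, integral_Icc_mul_cpow_neg hs1 hnr hnx, show 1 - s = 1 + -s by ring,
    Complex.cpow_add _ _ hxc, Complex.ofReal_natCast, Complex.cpow_add _ _ hnc, Complex.cpow_one,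
    Complex.cpow_one]
  have hxs : (x : ℂ) ^ s * (x : ℂ) ^ (-s) = 1 := by
    rw [← Complex.cpow_add _ _ hxc]; simp
  have e : (x : ℂ) ^ s * ((n : ℂ) * (n : ℂ) ^ (-s) - x * (x : ℂ) ^ (-s)) =
    (x : ℂ) ^ s * (n * (n : ℂ) ^ (-s)) - ((x : ℂ) ^ s * (x : ℂ) ^ (-s)) * x := by ring
  rw [e, hxs, Complex.cpow_neg]
  have hns : (n : ℂ) ^ s ≠ 0 := by
    intro h; exact hnc ((Complex.cpow_eq_zero_iff _ _).1 h).1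
  field_simp

/-! ### The comparison inequality and the two constants used in it. -/

theorem measurable_mobM : Measurable mobM :=
  (measurable_from_nat (f := fun N : ℕ =>
    ∑ n ∈ Finset.Icc 1 N, (ArithmeticFunction.moebius n : ℝ) / (n : ℝ))).comp Nat.measurable_floor

theorem abs_mobM_le {t x : ℝ} (h : t ≤ x) :
    |mobM t| ≤ ∑ n ∈ Finset.Icc 1 ⌊x⌋₊, |(ArithmeticFunction.moebius n : ℝ) / (n : ℝ)| :=
  (Finset.abs_sum_le_sum_abs _ _).trans (Finset.sum_le_sum_of_subset_of_nonneg
    (Finset.Icc_subset_Icc_right (Nat.floor_mono h)) fun _ _ _ => abs_nonneg _)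

theorem integrableOn_abs_mobM (x : ℝ) : IntegrableOn (fun t => |mobM t|) (Icc 1 x) := by
  refine Integrable.mono' (g := fun _ => ∑ n ∈ Finset.Icc 1 ⌊x⌋₊,
    |(ArithmeticFunction.moebius n : ℝ) / (n : ℝ)|) ?_
    (measurable_mobM.abs.aestronglyMeasurable) ?_
  · exact integrableOn_const (by simp)
  · filter_upwards [ae_restrict_mem measurableSet_Icc] with t ht
    rw [Real.norm_eq_abs, abs_abs]
    exact abs_mobM_le ht.2

theorem intervalIntegrable_abs_mobM {a b : ℝ} (ha : 1 ≤ a) (hab : a ≤ b) :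
    IntervalIntegrable (fun t => |mobM t|) volume a b := by
  rw [intervalIntegrable_iff_integrableOn_Ioc_of_le hab]
  exact (integrableOn_abs_mobM b).mono_set fun t ht => ⟨ha.trans ht.1.le, ht.2⟩

theorem integral_abs_mobM_nonneg {x : ℝ} (hx : 1 ≤ x) : 0 ≤ ∫ t in (1 : ℝ)..x, |mobM t| :=
  intervalIntegral.integral_nonneg hx fun _ _ => abs_nonneg _

/-- Subtract ζ(s) times `integral_mobM_mul_cpow` from `integral_mobM_mul_mobKernel`; what is left
under the integral is m(t) times the bounded kernel error at x/t ≥ 1. -/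
theorem norm_cpow_sub_sub_le {s : ℂ} (hs1 : s ≠ 1) {C : ℝ}
    (hC : ∀ y : ℝ, 1 ≤ y → ‖mobKernel s y - (s - 1) * riemannZeta s * (y : ℂ) ^ s‖ ≤ C)
    {x : ℝ} (hx : 1 ≤ x) :
    ‖(x : ℂ) ^ s - 1 / x - riemannZeta s * ((x : ℂ) ^ s * mobDirichlet s x - x * mobM x)‖ ≤
      C * ∫ t in (1 : ℝ)..x, |mobM t| := by
  have hmI : IntegrableOn (fun t => (mobM t : ℂ)) (Icc 1 x) := by
    refine Integrable.mono' (integrableOn_abs_mobM x)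
      (Complex.measurable_ofReal.comp measurable_mobM).aestronglyMeasurable
      (Eventually.of_forall fun t => ?_)
    rw [Complex.norm_real, Real.norm_eq_abs]
  have hmul : ∀ g : ℝ → ℂ, IntegrableOn g (Icc 1 x) →
      IntegrableOn (fun t => (mobM t : ℂ) * g t) (Icc 1 x) := fun g hg => by
    refine Integrable.bdd_mul hg
      (Complex.measurable_ofReal.comp measurable_mobM).aestronglyMeasurable
      (c := ∑ n ∈ Finset.Icc 1 ⌊x⌋₊, |(ArithmeticFunction.moebius n : ℝ) / (n : ℝ)|) ?_
    filter_upwards [ae_restrict_mem measurableSet_Icc] with t ht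
    rw [Complex.norm_real, Real.norm_eq_abs]
    exact abs_mobM_le ht.2
  have hx0 : 0 < x := one_pos.trans_le hx
  have hg2 : IntegrableOn (fun t : ℝ => (s - 1) * ((x / t : ℝ) : ℂ) ^ s) (Icc 1 x) := by
    refine ContinuousOn.integrableOn_Icc fun t ht => ContinuousAt.continuousWithinAt ?_
    have ht0 : 0 < t := one_pos.trans_le ht.1
    refine continuousAt_const.mul (ContinuousAt.comp (g := fun u : ℝ => (u : ℂ) ^ s)
      (f := fun t : ℝ => x / t)
      (Complex.continuousAt_ofReal_cpow_const _ s (Or.inr (div_pos hx0 ht0).ne'))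
      (continuousAt_const.div continuousAt_id ht0.ne'))
  rw [← integral_mobM_mul_cpow hs1 hx, ← integral_mobM_mul_mobKernel hs1 hx, ← integral_const_mul,
    ← integral_sub (hmul _ (integrableOn_mobKernel_div s x)) ((hmul _ hg2).const_mul _),
    intervalIntegral.integral_of_le hx, ← integral_Icc_eq_integral_Ioc, ← integral_const_mul]
  refine norm_integral_le_of_norm_le ((integrableOn_abs_mobM x).const_mul C) ?_
  filter_upwards [ae_restrict_mem measurableSet_Icc] with t ht
  have ht0 : 0 < t := one_pos.trans_le ht.1
  have h1 : 1 ≤ x / t := (one_le_div ht0).2 ht.2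
  have e : (mobM t : ℂ) * mobKernel s (x / t) -
      riemannZeta s * ((mobM t : ℂ) * ((s - 1) * ((x / t : ℝ) : ℂ) ^ s)) =
      (mobM t : ℂ) * (mobKernel s (x / t) -
        (s - 1) * riemannZeta s * ((x / t : ℝ) : ℂ) ^ s) := by ring
  rw [e, norm_mul, Complex.norm_real, Real.norm_eq_abs, mul_comm C]
  exact mul_le_mul_of_nonneg_left (hC _ h1) (abs_nonneg _)

theorem norm_mobKernel_sub_le_of_re_pos {s : ℂ} (hs : 0 < s.re) (hs1 : s ≠ 1) {y : ℝ}
    (hy : 1 ≤ y) :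
    ‖mobKernel s y - (s - 1) * riemannZeta s * (y : ℂ) ^ s‖ ≤ 1 + ‖s - 1‖ * ‖s‖ / s.re := by
  -- The shift c = {y} kills the boundary error and leaves |{u} - {y}| ≤ 1 in the tail.
  have := norm_mobKernel_sub_le hs hs1 hy (c := Int.fract y) (d := 0) (K := 1) (by simp)
    (fun u => by
      rw [abs_le]
      have := Int.fract_nonneg u; have := Int.fract_lt_one u
      have := Int.fract_nonneg y; have := Int.fract_lt_one y
      constructor <;> linarith)
  rwa [zero_add, one_mul, ← mul_div_assoc] at this

/-- Centring at c = 1/2 roughly halves the constant when |s|/Re s is large, which the explicit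
constant 0.0025 requires. -/
theorem norm_mobKernel_sub_le_half {s : ℂ} (hs : 0 < s.re) (hs1 : s ≠ 1) {y : ℝ}
    (hy : 1 ≤ y) :
    ‖mobKernel s y - (s - 1) * riemannZeta s * (y : ℂ) ^ s‖ ≤
      1 + ‖s - 1‖ * (1 / 2 + 1 / 2 * (‖s‖ / s.re)) := by
  have h : ∀ u : ℝ, |Int.fract u - 1 / 2| ≤ 1 / 2 := fun u => by
    rw [abs_le]
    have := Int.fract_nonneg u; have := Int.fract_lt_one u
    constructor <;> linarith
  exact norm_mobKernel_sub_le hs hs1 hy (h y) h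

/-! ### Consequences of a zero of ζ. -/

theorem rpow_sub_le_of_riemannZeta_eq_zero {ρ : ℂ} (hρ : riemannZeta ρ = 0) {C : ℝ}
    (hC : ∀ y : ℝ, 1 ≤ y → ‖mobKernel ρ y - (ρ - 1) * riemannZeta ρ * (y : ℂ) ^ ρ‖ ≤ C)
    {x : ℝ} (hx : 1 ≤ x) :
    x ^ ρ.re - 1 / x ≤ C * ∫ t in (1 : ℝ)..x, |mobM t| := by
  have hx0 : 0 < x := one_pos.trans_le hx
  have hρ1 : ρ ≠ 1 := by rintro rfl; exact riemannZeta_one_ne_zero hρ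
  have := norm_cpow_sub_sub_le hρ1 hC hx
  rw [hρ, zero_mul, sub_zero] at this
  refine le_trans ?_ this
  refine le_trans ?_ (norm_sub_norm_le _ _)
  rw [Complex.norm_cpow_eq_rpow_re_of_pos hx0, norm_div, Complex.norm_real, norm_one,
    Real.norm_of_nonneg hx0.le]

/-- In the functional equation at 1 - s only the cosine can vanish, and it does so only at even
integers s; the sole one in the strip is 0, where ζ(0) = -1/2. -/
theorem riemannZeta_ne_zero_of_neg_one_lt_re_of_re_nonpos {s : ℂ} (h1 : -1 < s.re)
    (h2 : s.re ≤ 0) : riemannZeta s ≠ 0 := by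
  by_cases hs0 : s = 0
  · rw [hs0, riemannZeta_zero]; norm_num
  have hre : (1 - s).re = 1 - s.re := by simp
  have hz := riemannZeta_ne_zero_of_one_le_re (s := 1 - s) (by rw [hre]; linarith)
  have h := riemannZeta_one_sub (s := 1 - s) (fun n h => by
    have := congrArg Complex.re h
    rw [hre] at this
    simp at this
    have : (0 : ℝ) ≤ n := n.cast_nonneg
    linarith) (fun h => hs0 (by linear_combination -h))
  rw [sub_sub_cancel] at h
  rw [h]
  refine mul_ne_zero (mul_ne_zero (mul_ne_zero (mul_ne_zero two_ne_zero ?_) ?_) ?_) hz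
  · intro h0
    have := ((Complex.cpow_eq_zero_iff _ _).1 h0).1
    simp [Real.pi_ne_zero] at this
  · exact Complex.Gamma_ne_zero_of_re_pos (by rw [hre]; linarith)
  · intro h0
    obtain ⟨k, hk⟩ := Complex.cos_eq_zero_iff.1 h0
    have hpi : (Real.pi : ℂ) ≠ 0 := by exact_mod_cast Real.pi_ne_zero
    have hk' : 1 - s = 2 * k + 1 := by
      field_simp at hk
      linear_combination hk
    have hsk : s = ((-2 * k : ℤ) : ℂ) := by push_cast; linear_combination -hk'
    have hr : s.re = ((-2 * k : ℤ) : ℝ) := by rw [hsk, Complex.intCast_re]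
    rw [hr] at h1 h2
    have a1 : -1 < -2 * k := by exact_mod_cast h1
    have a2 : -2 * k ≤ 0 := by exact_mod_cast h2
    have : k = 0 := by omega
    exact hs0 (by rw [hsk, this]; simp)

theorem integral_abs_mobM_ge_of_riemannZeta_eq_zero {ρ : ℂ} (hρ : riemannZeta ρ = 0)
    {x : ℝ} (hx : 1 ≤ x) :
    (1 + ‖ρ - 1‖ * ‖ρ‖ / |ρ.re|)⁻¹ * (x ^ ρ.re - 1 / x) ≤ ∫ t in (1 : ℝ)..x, |mobM t| := by
  have hρ1 : ρ ≠ 1 := by rintro rfl; exact riemannZeta_one_ne_zero hρ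
  have hC : 0 < 1 + ‖ρ - 1‖ * ‖ρ‖ / |ρ.re| := by positivity
  -- For Re ρ ≤ -1 one has x^(Re ρ) ≤ 1/x, so the lower bound is not positive.
  rcases le_or_gt ρ.re (-1) with h | h
  · refine le_trans ?_ (integral_abs_mobM_nonneg hx)
    refine mul_nonpos_of_nonneg_of_nonpos (inv_nonneg.2 hC.le) ?_
    have := Real.rpow_le_rpow_of_exponent_le hx h
    rw [Real.rpow_neg_one] at this
    rw [one_div]; linarith
  rcases le_or_gt ρ.re 0 with h0 | h0
  · exact absurd hρ (riemannZeta_ne_zero_of_neg_one_lt_re_of_re_nonpos h h0)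
  rw [inv_mul_le_iff₀ hC, abs_of_pos h0]
  exact rpow_sub_le_of_riemannZeta_eq_zero hρ
    (fun y hy => norm_mobKernel_sub_le_of_re_pos h0 hρ1 hy) hx

theorem norm_sub_one_and_sq_norm_of_re_eq_one {s : ℂ} (hs : s.re = 1) :
    ‖s - 1‖ = |s.im| ∧ ‖s‖ ^ 2 = 1 + s.im ^ 2 := by
  constructor
  · have : s - 1 = s.im * Complex.I := by
      apply Complex.ext <;> simp [hs]
    rw [this, norm_mul, Complex.norm_I, mul_one, Complex.norm_real, Real.norm_eq_abs]
  · rw [Complex.sq_norm, Complex.normSq_apply, hs]; ring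

/-- The integral of |m| grows at most like (ε + δ)x plus a constant, so comparing slopes as x → ∞
gives 1 ≤ C(ε + δ); then δ tends to 0. -/
theorem one_le_mul_of_integral_le {C ε : ℝ} (hC : 0 ≤ C)
    (h : ∀ x : ℝ, 1 ≤ x → x - 1 / x ≤ C * ∫ t in (1 : ℝ)..x, |mobM t|)
    (hm : ∀ δ > 0, ∀ᶠ x in atTop, |mobM x| ≤ ε + δ) : 1 ≤ C * ε := by
  have key : ∀ δ > 0, 1 ≤ C * (ε + δ) := by
    intro δ hδ
    by_contra! hlt
    obtain ⟨X, hX⟩ := eventually_atTop.1 (hm δ hδ)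
    set Y := max X 1
    have hY1 : 1 ≤ Y := le_max_right _ _
    set A := ∫ t in (1 : ℝ)..Y, |mobM t|
    have hεδ : 0 ≤ ε + δ := (abs_nonneg _).trans (hX X le_rfl)
    have hA : 0 ≤ A := integral_abs_mobM_nonneg hY1
    have hlin : ∀ x, Y ≤ x → x - 1 ≤ C * (A + (ε + δ) * x) := by
      intro x hx
      have hx1 : 1 ≤ x := hY1.trans hx
      have h1 : ∫ t in Y..x, |mobM t| ≤ ∫ t in Y..x, (ε + δ) :=
        intervalIntegral.integral_mono_on hx (intervalIntegrable_abs_mobM hY1 hx)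
          intervalIntegrable_const fun t ht => hX t ((le_max_left _ _).trans ht.1)
      have h2 := intervalIntegral.integral_add_adjacent_intervals
        (intervalIntegrable_abs_mobM le_rfl hY1) (intervalIntegrable_abs_mobM hY1 hx)
      rw [intervalIntegral.integral_const, smul_eq_mul] at h1
      have h3 := h x hx1
      have h4 : 1 / x ≤ 1 := (div_le_one (by linarith)).2 hx1
      rw [← h2] at h3
      refine le_trans (by linarith) (h3.trans (mul_le_mul_of_nonneg_left ?_ hC))
      have : (x - Y) * (ε + δ) ≤ x * (ε + δ) := mul_le_mul_of_nonneg_right (by linarith) hεδ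
      linarith
    have hk : 0 < 1 - C * (ε + δ) := by linarith
    set x := max Y ((C * A + 2) / (1 - C * (ε + δ)))
    have h5 := hlin x (le_max_left _ _)
    have h6 : C * A + 2 ≤ x * (1 - C * (ε + δ)) := (div_le_iff₀ hk).1 (le_max_right _ _)
    linarith
  by_contra! hlt
  have hk : 0 < 1 - C * ε := by linarith
  -- This δ makes Cδ < 1 - Cε; the denominator C + 1 covers C = 0.
  have := key ((1 - C * ε) / (C + 1) / 2) (by positivity)
  have h7 : C * ((1 - C * ε) / (C + 1) / 2) < 1 - C * ε := by
    rw [div_div, ← mul_div_assoc, div_lt_iff₀ (by positivity)]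
    nlinarith
  linarith

theorem le_abs_im_of_riemannZeta_eq_zero {ρ : ℂ} (hρ : riemannZeta ρ = 0) (hre : ρ.re = 1)
    {ε : ℝ} (hε : 0 < ε) (hm : ∀ δ > 0, ∀ᶠ x in atTop, |mobM x| ≤ ε + δ) :
    1 / Real.sqrt ε - 1 ≤ |ρ.im| := by
  have hC : 0 < 1 + ‖ρ - 1‖ * ‖ρ‖ / |ρ.re| := by positivity
  have h1 := one_le_mul_of_integral_le hC.le (fun x hx => by
    have := integral_abs_mobM_ge_of_riemannZeta_eq_zero hρ hx
    have e : x ^ ρ.re = x := by rw [hre, Real.rpow_one]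
    rwa [inv_mul_le_iff₀ hC, e] at this) hm
  obtain ⟨e1, e2⟩ := norm_sub_one_and_sq_norm_of_re_eq_one hre
  rw [hre, abs_one, div_one, e1] at h1
  have h2 : ‖ρ‖ ≤ 1 + |ρ.im| := by
    refine abs_le_of_sq_le_sq' ?_ (by positivity) |>.2
    rw [e2]
    have := sq_abs ρ.im
    nlinarith [abs_nonneg ρ.im]
  -- The constant of (1) is at most a perfect square, so a square root turns 1 ≤ Cε into the stated
  -- bound.
  have h3 : 1 + |ρ.im| * ‖ρ‖ ≤ (1 + |ρ.im|) ^ 2 := by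
    nlinarith [abs_nonneg ρ.im]
  have h4 : 1 ≤ ((1 + |ρ.im|) * Real.sqrt ε) ^ 2 := by
    rw [mul_pow, Real.sq_sqrt hε.le]
    exact h1.trans (mul_le_mul_of_nonneg_right h3 hε.le)
  have h5 : 1 ≤ (1 + |ρ.im|) * Real.sqrt ε := by
    have h0 : 0 ≤ (1 + |ρ.im|) * Real.sqrt ε := by positivity
    nlinarith
  rw [sub_le_iff_le_add, div_le_iff₀ (Real.sqrt_pos.2 hε)]
  linarith

theorem riemannZeta_ne_zero_of_isLittleO_mobM
    (hm : Asymptotics.IsLittleO atTop mobM (fun _ => (1 : ℝ))) {s : ℂ} (hs : s.re = 1) :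
    riemannZeta s ≠ 0 := by
  intro hz
  have hlim : Tendsto mobM atTop (𝓝 0) := (Asymptotics.isLittleO_one_iff ℝ).1 hm
  have hp : 0 < |s.im| + 2 := by positivity
  -- With 1/√ε = |Im s| + 2 the bound on the ordinate becomes |Im s| + 1 ≤ |Im s|.
  have := le_abs_im_of_riemannZeta_eq_zero hz hs (ε := ((|s.im| + 2) ^ 2)⁻¹) (by positivity)
    (fun δ hδ => by
      filter_upwards [Metric.tendsto_nhds.1 hlim δ hδ] with x hx
      rw [dist_zero_right, Real.norm_eq_abs] at hx
      have : 0 < ((|s.im| + 2) ^ 2)⁻¹ := by positivity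
      linarith)
  rw [Real.sqrt_inv, Real.sqrt_sq hp.le, one_div, inv_inv] at this
  linarith

/-! ### Partial sums of μ(n)/n^s on Re s = 1. -/

/-- Divide the comparison inequality by ζ(s) x^s, where |x^s| = x. The constant 3/2 in place of 2
keeps a reserve of 1/2 for the case x ≥ 2. -/
theorem norm_mobDirichlet_sub_le {t : ℝ} (ht : t ≠ 0) {x : ℝ} (hx : 1 ≤ x) :
    ‖mobDirichlet (1 + t * Complex.I) x - 1 / riemannZeta (1 + t * Complex.I)‖ ≤
      (3 / 2 + t ^ 2) / ‖riemannZeta (1 + t * Complex.I)‖ *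
        (1 / x * ∫ u in (1 : ℝ)..x, |mobM u|) +
        |mobM x| + 1 / (‖riemannZeta (1 + t * Complex.I)‖ * x ^ 2) := by
  set s : ℂ := 1 + t * Complex.I with hs
  have hre : s.re = 1 := by simp [hs]
  have him : s.im = t := by simp [hs]
  have hs1 : s ≠ 1 := fun h => ht (by rw [← him, h, Complex.one_im])
  have hx0 : 0 < x := one_pos.trans_le hx
  have hxc : (x : ℂ) ≠ 0 := by exact_mod_cast hx0.ne'
  have hz : riemannZeta s ≠ 0 := riemannZeta_ne_zero_of_one_le_re hre.ge
  have hzn : 0 < ‖riemannZeta s‖ := norm_pos_iff.2 hz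
  obtain ⟨e1, e2⟩ := norm_sub_one_and_sq_norm_of_re_eq_one hre
  rw [him] at e1 e2
  -- From 2|t||s| ≤ t² + |s|² = 1 + 2t².
  have hC : 1 + ‖s - 1‖ * ‖s‖ / s.re ≤ 3 / 2 + t ^ 2 := by
    rw [hre, div_one, e1]
    have := sq_abs t
    nlinarith [sq_nonneg (|t| - ‖s‖)]
  have hI := integral_abs_mobM_nonneg hx
  have h1 := (norm_cpow_sub_sub_le hs1
    (fun y hy => norm_mobKernel_sub_le_of_re_pos (by rw [hre]; exact one_pos) hs1 hy) hx).trans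
    (mul_le_mul_of_nonneg_right hC hI)
  set E := (x : ℂ) ^ s - 1 / x - riemannZeta s * ((x : ℂ) ^ s * mobDirichlet s x - x * mobM x)
    with hE
  have hxs : (x : ℂ) ^ s ≠ 0 := fun h => hxc ((Complex.cpow_eq_zero_iff _ _).1 h).1
  have hxn : ‖(x : ℂ) ^ s‖ = x := by
    rw [Complex.norm_cpow_eq_rpow_re_of_pos hx0, hre, Real.rpow_one]
  have key : mobDirichlet s x - 1 / riemannZeta s =
      -(E / (riemannZeta s * (x : ℂ) ^ s)) + x * mobM x / (x : ℂ) ^ s -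
        1 / (riemannZeta s * (x * (x : ℂ) ^ s)) := by
    rw [hE]; field_simp; ring
  rw [key]
  refine (norm_sub_le _ _).trans (add_le_add ((norm_add_le _ _).trans (add_le_add ?_ ?_)) ?_)
  · rw [norm_neg, norm_div, norm_mul, hxn, div_le_iff₀ (by positivity)]
    refine h1.trans (le_of_eq ?_)
    field_simp
  · rw [norm_div, norm_mul, hxn, Complex.norm_real, Complex.norm_real, Real.norm_eq_abs,
      Real.norm_eq_abs, abs_of_pos hx0, mul_div_cancel_left₀ _ hx0.ne']
  · rw [norm_div, norm_mul, norm_mul, hxn, Complex.norm_real, Real.norm_eq_abs, abs_of_pos hx0,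
      norm_one, sq]

theorem one_le_integral_abs_mobM {x : ℝ} (hx : 2 ≤ x) : 1 ≤ ∫ t in (1 : ℝ)..x, |mobM t| := by
  have h1 : ∫ t in (1 : ℝ)..2, |mobM t| = 1 := by
    have : ∫ t in (1 : ℝ)..2, |mobM t| = ∫ t in (1 : ℝ)..2, (1 : ℝ) := by
      rw [intervalIntegral.integral_of_le one_le_two, intervalIntegral.integral_of_le one_le_two,
        integral_Ioc_eq_integral_Ioo, integral_Ioc_eq_integral_Ioo]
      refine setIntegral_congr_fun measurableSet_Ioo fun t ht => ?_
      have : ⌊t⌋₊ = 1 := by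
        rw [Nat.floor_eq_iff (by linarith [ht.1])]
        norm_num; exact ⟨ht.1.le, ht.2⟩
      simp [mobM, this]
    rw [this]; norm_num
  have h2 := intervalIntegral.integral_add_adjacent_intervals
    (intervalIntegrable_abs_mobM le_rfl one_le_two) (intervalIntegrable_abs_mobM one_le_two hx)
  have h3 : 0 ≤ ∫ t in (2 : ℝ)..x, |mobM t| :=
    intervalIntegral.integral_nonneg hx fun _ _ => abs_nonneg _
  linarith

theorem norm_mobDirichlet_sub_le_of_one_le {t : ℝ} (ht : t ≠ 0) {x : ℝ} (hx : 1 ≤ x) :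
    ‖mobDirichlet (1 + t * Complex.I) x - 1 / riemannZeta (1 + t * Complex.I)‖ ≤
      (2 + t ^ 2) / ‖riemannZeta (1 + t * Complex.I)‖ *
        (1 / x * ∫ u in (1 : ℝ)..x, |mobM u|) +
        |mobM x| + 1 / (‖riemannZeta (1 + t * Complex.I)‖ * x ^ 2) := by
  refine (norm_mobDirichlet_sub_le ht hx).trans ?_
  have hI := integral_abs_mobM_nonneg hx
  gcongr
  norm_num

/-- The term 1/(|ζ| x²) is absorbed by the spare 1/2 in 2 + t², since |m| = 1 on [1, 2) makes the
integral at least 1. The final 1/x² is then pure slack. -/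
theorem norm_mobDirichlet_sub_le_of_two_le {t : ℝ} (ht : t ≠ 0) {x : ℝ} (hx : 2 ≤ x) :
    ‖mobDirichlet (1 + t * Complex.I) x - 1 / riemannZeta (1 + t * Complex.I)‖ ≤
      (2 + t ^ 2) / ‖riemannZeta (1 + t * Complex.I)‖ *
        (1 / x * ∫ u in (1 : ℝ)..x, |mobM u|) +
        |mobM x| + 1 / x ^ 2 := by
  have hx0 : 0 < x := by linarith
  have hI := one_le_integral_abs_mobM hx
  have hz : 0 < ‖riemannZeta (1 + t * Complex.I)‖ :=
    norm_pos_iff.2 (riemannZeta_ne_zero_of_one_le_re (by simp))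
  have h1 := norm_mobDirichlet_sub_le ht (one_le_two.trans hx)
  set Z := ‖riemannZeta (1 + t * Complex.I)‖
  set I := ∫ u in (1 : ℝ)..x, |mobM u|
  have h2 : 1 / (Z * x ^ 2) ≤ 1 / 2 / Z * (1 / x * I) := by
    rw [div_mul_eq_mul_div, div_le_div_iff₀ (by positivity) hz]
    have e : 1 / 2 * (1 / x * I) * (Z * x ^ 2) = Z * (x / 2 * I) := by field_simp
    rw [e, one_mul]
    nlinarith [mul_le_mul (show (1 : ℝ) ≤ x / 2 by linarith) hI zero_le_one (by linarith)]
  have h3 : (2 + t ^ 2) / Z * (1 / x * I) =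
      (3 / 2 + t ^ 2) / Z * (1 / x * I) + 1 / 2 / Z * (1 / x * I) := by ring
  have h4 : 0 < 1 / x ^ 2 := by positivity
  rw [h3]
  linarith

/-! ### Euler–Maclaurin summation of order six. -/

theorem exists_norm_comp_fract_le {p : ℝ → ℝ} (hp : Continuous p) :
    ∃ C : ℝ, ∀ u : ℝ, ‖((p (Int.fract u) : ℝ) : ℂ)‖ ≤ C := by
  obtain ⟨C, hC⟩ := (isCompact_Icc (a := (0 : ℝ)) (b := 1)).exists_bound_of_continuousOn
    hp.continuousOn
  refine ⟨C, fun u => ?_⟩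
  rw [Complex.norm_real]
  exact hC _ ⟨Int.fract_nonneg u, (Int.fract_lt_one u).le⟩

theorem integrableOn_comp_fract_mul_cpow {p : ℝ → ℝ} (hp : Continuous p) {y : ℝ} (hy : 0 < y)
    {a : ℂ} (ha : a.re < -1) :
    IntegrableOn (fun u : ℝ => ((p (Int.fract u) : ℝ) : ℂ) * (u : ℂ) ^ a) (Ioi y) := by
  obtain ⟨C, hC⟩ := exists_norm_comp_fract_le hp
  exact integrableOn_Ioi_mul_cpow
    (Complex.measurable_ofReal.comp (hp.measurable.comp measurable_fract)) hC hy ha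

/-- The fractional part is smooth to the right of every point, integers included, so the
right-derivative form of the fundamental theorem applies without splitting at integers. -/
theorem hasDerivWithinAt_comp_fract {p q : ℝ → ℝ} (hq : ∀ v, HasDerivAt q (p v) v) (x : ℝ) :
    HasDerivWithinAt (fun u => q (Int.fract u)) (p (Int.fract x)) (Ioi x) x := by
  have h1 : HasDerivAt (fun u : ℝ => q (u - ⌊x⌋)) (p (Int.fract x)) x := by
    have := (hq (Int.fract x)).comp_of_eq x ((hasDerivAt_id x).sub_const (⌊x⌋ : ℝ)) rfl
    simpa using! this
  refine h1.hasDerivWithinAt.congr_of_eventuallyEq ?_ rfl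
  have : Ioo x (⌊x⌋ + 1) ∈ 𝓝[>] x := Ioo_mem_nhdsGT (Int.lt_floor_add_one x)
  filter_upwards [this] with u hu
  have : ⌊u⌋ = ⌊x⌋ := Int.floor_eq_iff.2 ⟨(Int.floor_le x).trans hu.1.le, hu.2⟩
  rw [Int.fract, this]

/-- Integration by parts on `(N, ∞)` against a `1`-periodic function. -/
theorem integral_comp_fract_mul_cpow {p q : ℝ → ℝ} (hq : ∀ v, HasDerivAt q (p v) v)
    (hp : Continuous p) (h0 : q 0 = 0) (h1 : q 1 = 0) {N : ℕ} (hN : 0 < N) {a : ℂ}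
    (ha : 1 < a.re) :
    ∫ u in Ioi (N : ℝ), ((p (Int.fract u) : ℝ) : ℂ) * (u : ℂ) ^ (-a) =
      a * ∫ u in Ioi (N : ℝ), ((q (Int.fract u) : ℝ) : ℂ) * (u : ℂ) ^ (-(a + 1)) := by
  have hN0 : (0 : ℝ) < N := by exact_mod_cast hN
  have hqc : Continuous q := continuous_iff_continuousAt.2 fun v => (hq v).continuousAt
  have hi1 := integrableOn_comp_fract_mul_cpow hp hN0 (a := -a) (by simpa using ha)
  have hi2 := integrableOn_comp_fract_mul_cpow hqc hN0 (a := -(a + 1)) (by simp; linarith)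
  obtain ⟨C, hC⟩ := exists_norm_comp_fract_le hqc
  rw [← sub_eq_zero, ← integral_const_mul, ← integral_sub hi1 (hi2.const_mul a)]
  set F : ℝ → ℂ := fun u => ((q (Int.fract u) : ℝ) : ℂ) * (u : ℂ) ^ (-a) with hF
  have hlim := intervalIntegral_tendsto_integral_Ioi (N : ℝ) (hi1.sub (hi2.const_mul a)) tendsto_id
  have hFt : Tendsto F atTop (𝓝 0) := by
    have h2 : Tendsto (fun u : ℝ => C * u ^ (-a.re)) atTop (𝓝 0) := by
      simpa using (tendsto_rpow_neg_atTop (by linarith : 0 < a.re)).const_mul C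
    refine squeeze_zero_norm' ?_ h2
    filter_upwards [eventually_gt_atTop 0] with u hu
    rw [hF, norm_mul, Complex.norm_cpow_eq_rpow_re_of_pos hu, Complex.neg_re]
    exact mul_le_mul_of_nonneg_right (hC u) (Real.rpow_nonneg hu.le _)
  refine tendsto_nhds_unique hlim (hFt.congr' ?_)
  filter_upwards [eventually_ge_atTop (N : ℝ)] with b hb
  -- Equal values of q at 0 and 1 remove the jumps at integers.
  have hqf : Continuous fun u : ℝ => q (Int.fract u) :=
    ContinuousOn.comp_fract'' hqc.continuousOn (h0.trans h1.symm)
  have key := intervalIntegral.integral_eq_sub_of_hasDeriv_right_of_le (f := F)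
    (f' := fun u : ℝ => ((p (Int.fract u) : ℝ) : ℂ) * (u : ℂ) ^ (-a) -
      a * (((q (Int.fract u) : ℝ) : ℂ) * (u : ℂ) ^ (-(a + 1)))) hb ?_ ?_ ?_
  · have hFN : F N = 0 := by simp [hF, h0]
    rw [hFN, sub_zero] at key
    exact key.symm
  · intro u hu
    exact ((Complex.continuous_ofReal.comp hqf).continuousAt.mul
      (Complex.continuousAt_ofReal_cpow_const u (-a)
        (Or.inr (hN0.trans_le hu.1).ne'))).continuousWithinAt
  · intro u hu
    have hu0 : 0 < u := hN0.trans hu.1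
    have d1 := (hasDerivWithinAt_comp_fract hq u).ofReal_comp
    have hane : -a ≠ 0 := by
      intro h; have := congrArg Complex.re h; simp at this; linarith
    have d3 := hasDerivAt_ofReal_cpow_const (x := u) hu0.ne' hane
    refine (d1.mul d3.hasDerivWithinAt).congr_deriv ?_
    rw [show -(a + 1) = -a - 1 by ring]
    ring
  · rw [intervalIntegrable_iff_integrableOn_Ioc_of_le hb]
    exact (hi1.sub (hi2.const_mul a)).mono_set Ioc_subset_Ioi_self

/-- A primitive vanishing at both 0 and 1 exists only for mean-zero p. The added constant restores
mean zero before the next integration by parts and produces the Euler–Maclaurin correction terms. -/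
theorem integral_comp_fract_add_const_mul_cpow {p : ℝ → ℝ} (hp : Continuous p) (c : ℝ) {N : ℕ}
    (hN : 0 < N) {a : ℂ} (ha : 0 < a.re) :
    ∫ u in Ioi (N : ℝ), ((p (Int.fract u) : ℝ) : ℂ) * (u : ℂ) ^ (-(a + 1)) =
      (∫ u in Ioi (N : ℝ), ((p (Int.fract u) + c : ℝ) : ℂ) * (u : ℂ) ^ (-(a + 1))) -
        c * ((N : ℂ) ^ (-a) / a) := by
  have hN0 : (0 : ℝ) < N := by exact_mod_cast hN
  have hre : (-(a + 1)).re < -1 := by simp; linarith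
  have hi1 := integrableOn_comp_fract_mul_cpow hp hN0 hre
  have hi2 : IntegrableOn (fun u : ℝ => (u : ℂ) ^ (-(a + 1))) (Ioi (N : ℝ)) :=
    integrableOn_Ioi_cpow_of_lt hre hN0
  have h2 : ∫ u in Ioi (N : ℝ), (u : ℂ) ^ (-(a + 1)) = (N : ℂ) ^ (-a) / a := by
    rw [integral_Ioi_cpow_of_lt hre hN0, show -(a + 1) + 1 = -a by ring, neg_div_neg_eq,
      Complex.ofReal_natCast]
  rw [← h2, eq_sub_iff_add_eq, ← integral_const_mul, ← integral_add hi1 (hi2.const_mul _)]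
  congr 1; ext u; push_cast; ring

/-- The Euler–Maclaurin approximation of order six. -/
theorem riemannZeta_eq_eulerMaclaurin {s : ℂ} (hs : 0 < s.re) (hs1 : s ≠ 1) {N : ℕ} (hN : 0 < N) :
    riemannZeta s = ∑ k ∈ Finset.Icc 1 N, (k : ℂ) ^ (-s) + (N : ℂ) ^ (1 - s) / (s - 1) -
      (N : ℂ) ^ (-s) / 2 + s / 12 * (N : ℂ) ^ (-(s + 1)) -
      s * (s + 1) * (s + 2) / 720 * (N : ℂ) ^ (-(s + 3)) -
      s * (s + 1) * (s + 2) * (s + 3) * (s + 4) * (s + 5) * ∫ u in Ioi (N : ℝ),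
        ((Int.fract u ^ 6 / 720 - Int.fract u ^ 5 / 240 + Int.fract u ^ 4 / 288 -
          Int.fract u ^ 2 / 1440 : ℝ) : ℂ) * (u : ℂ) ^ (-(s + 6)) := by
  have hne : ∀ c : ℝ, 0 ≤ c → s + c ≠ 0 := fun c hc h => by
    have := congrArg Complex.re h; simp at this; linarith
  have n0 : s ≠ 0 := by simpa using hne 0 le_rfl
  have n1 : s + 1 ≠ 0 := by simpa using hne 1 zero_le_one
  have n3 : s + 3 ≠ 0 := by simpa using hne 3 (by norm_num)
  have hs2 : s - 1 ≠ 0 := sub_ne_zero.2 hs1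
  have hs3 : 1 - s ≠ 0 := sub_ne_zero.2 (Ne.symm hs1)
  have hN1 : (1 : ℝ) ≤ N := by exact_mod_cast hN
  have h := sum_cpow_eq_riemannZeta_add hs hs1 hN1
  rw [Nat.floor_natCast, Int.fract_natCast, Complex.ofReal_zero, zero_mul, sub_zero,
    Complex.ofReal_natCast] at h
  have e1 := integral_comp_fract_add_const_mul_cpow (p := fun v => v) continuous_id (-1 / 2) hN hs
  have e2 := integral_comp_fract_mul_cpow (p := fun v => v + -1 / 2) (q := fun v => v ^ 2 / 2 - v / 2)
    (fun v => (((hasDerivAt_pow 2 v).div_const 2).sub ((hasDerivAt_id v).div_const 2)).congr_deriv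
      (by norm_num; ring)) (by fun_prop) (by norm_num) (by norm_num) hN (a := s + 1)
    (by simp; linarith)
  have e3 := integral_comp_fract_add_const_mul_cpow (p := fun v => v ^ 2 / 2 - v / 2) (by fun_prop)
    (1 / 12) hN (a := s + 1) (by simp; linarith)
  have e4 := integral_comp_fract_mul_cpow (p := fun v => v ^ 2 / 2 - v / 2 + 1 / 12)
    (q := fun v => v ^ 3 / 6 - v ^ 2 / 4 + v / 12)
    (fun v => ((((hasDerivAt_pow 3 v).div_const 6).sub ((hasDerivAt_pow 2 v).div_const 4)).add
      ((hasDerivAt_id v).div_const 12)).congr_deriv (by norm_num; ring)) (by fun_prop)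
      (by norm_num) (by norm_num) hN (a := s + 2) (by simp; linarith)
  have e5 := integral_comp_fract_mul_cpow (p := fun v => v ^ 3 / 6 - v ^ 2 / 4 + v / 12)
    (q := fun v => v ^ 4 / 24 - v ^ 3 / 12 + v ^ 2 / 24)
    (fun v => ((((hasDerivAt_pow 4 v).div_const 24).sub ((hasDerivAt_pow 3 v).div_const 12)).add
      ((hasDerivAt_pow 2 v).div_const 24)).congr_deriv (by norm_num; ring)) (by fun_prop)
      (by norm_num) (by norm_num) hN (a := s + 3) (by simp; linarith)
  have e6 := integral_comp_fract_add_const_mul_cpow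
    (p := fun v => v ^ 4 / 24 - v ^ 3 / 12 + v ^ 2 / 24) (by fun_prop)
    (-1 / 720) hN (a := s + 3) (by simp; linarith)
  have e7 := integral_comp_fract_mul_cpow
    (p := fun v => v ^ 4 / 24 - v ^ 3 / 12 + v ^ 2 / 24 + -1 / 720)
    (q := fun v => v ^ 5 / 120 - v ^ 4 / 48 + v ^ 3 / 72 - v / 720)
    (fun v => (((((hasDerivAt_pow 5 v).div_const 120).sub ((hasDerivAt_pow 4 v).div_const 48)).add
      ((hasDerivAt_pow 3 v).div_const 72)).sub ((hasDerivAt_id v).div_const 720)).congr_deriv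
      (by norm_num; ring)) (by fun_prop) (by norm_num) (by norm_num) hN (a := s + 4)
      (by simp; linarith)
  have e8 := integral_comp_fract_mul_cpow
    (p := fun v => v ^ 5 / 120 - v ^ 4 / 48 + v ^ 3 / 72 - v / 720)
    (q := fun v => v ^ 6 / 720 - v ^ 5 / 240 + v ^ 4 / 288 - v ^ 2 / 1440)
    (fun v => (((((hasDerivAt_pow 6 v).div_const 720).sub ((hasDerivAt_pow 5 v).div_const 240)).add
      ((hasDerivAt_pow 4 v).div_const 288)).sub ((hasDerivAt_pow 2 v).div_const 1440)).congr_deriv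
      (by norm_num; ring)) (by fun_prop) (by norm_num) (by norm_num) hN (a := s + 5)
      (by simp; linarith)
  simp only [add_assoc] at e1 e2 e3 e4 e5 e6 e7 e8 h ⊢
  norm_num only at e1 e2 e3 e4 e5 e6 e7 e8 h ⊢
  rw [e1, e2, e3, e4, e5, e6, e7, e8] at h
  rw [h, show s - 1 = -(1 - s) by ring]
  generalize (∫ u in Ioi (N : ℝ),
    ((Int.fract u ^ 6 / 720 - Int.fract u ^ 5 / 240 + Int.fract u ^ 4 / 288 -
      Int.fract u ^ 2 / 1440 : ℝ) : ℂ) * (u : ℂ) ^ (-(s + 6))) = J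
  push_cast
  field_simp
  ring

theorem norm_eulerMaclaurin_integral_le {s : ℂ} (hs : 0 < s.re) {N : ℕ} (hN : 0 < N) :
    ‖∫ u in Ioi (N : ℝ), ((Int.fract u ^ 6 / 720 - Int.fract u ^ 5 / 240 + Int.fract u ^ 4 / 288 -
          Int.fract u ^ 2 / 1440 : ℝ) : ℂ) * (u : ℂ) ^ (-(s + 6))‖ ≤
      1 / 15360 * ((N : ℝ) ^ (-(s.re + 5)) / (s.re + 5)) := by
  have hN0 : (0 : ℝ) < N := by exact_mod_cast hN
  have := norm_integral_Ioi_mul_cpow_le (C := 1 / 15360) (y := N) (a := -(s + 6))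
    (P := fun u => ((Int.fract u ^ 6 / 720 - Int.fract u ^ 5 / 240 + Int.fract u ^ 4 / 288 -
          Int.fract u ^ 2 / 1440 : ℝ) : ℂ)) (fun u _ => ?_) hN0 (by simp; linarith)
  · rwa [show (-(s + 6)).re + 1 = -(s.re + 5) by simp; ring, neg_neg] at this
  · rw [Complex.norm_real, Real.norm_eq_abs]
    have h0 := Int.fract_nonneg u
    have h1 := (Int.fract_lt_one u).le
    set v := Int.fract u
    have hw0 : 0 ≤ v * (1 - v) := mul_nonneg h0 (by linarith)
    have hw1 : v * (1 - v) ≤ 1 / 4 := by nlinarith [sq_nonneg (v - 1 / 2)]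
    -- With w = v(1-v) the polynomial is -w²(1+2w)/1440; its modulus is largest at w = 1/4, which
    -- gives 1/15360.
    have e : v ^ 6 / 720 - v ^ 5 / 240 + v ^ 4 / 288 - v ^ 2 / 1440 =
        -((v * (1 - v)) ^ 2 * (1 + 2 * (v * (1 - v))) / 1440) := by ring
    rw [e, abs_neg, abs_of_nonneg (by positivity)]
    have : (v * (1 - v)) ^ 2 * (1 + 2 * (v * (1 - v))) ≤ (1 / 4) ^ 2 * (1 + 2 * (1 / 4)) := by
      gcongr
    linarith

/-! ### Approximating ζ near 1/2 + 14.135i. -/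

theorem norm_le_of_abs_re_le_of_abs_im_le {z : ℂ} {a b c : ℝ} (hc : 0 ≤ c) (h1 : |z.re| ≤ a)
    (h2 : |z.im| ≤ b) (h : a ^ 2 + b ^ 2 ≤ c ^ 2) : ‖z‖ ≤ c := by
  refine (sq_le_sq₀ (norm_nonneg _) hc).1 ?_
  rw [Complex.sq_norm, Complex.normSq_apply]
  have := sq_abs z.re
  have := sq_abs z.im
  nlinarith [abs_nonneg z.re, abs_nonneg z.im]

/-- Without a zero in the disc, the maximum modulus principle for 1/f contradicts |f| being smaller
at the centre than on the circle. -/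
theorem exists_eq_zero_of_norm_lt_on_sphere {f : ℂ → ℂ} {z₀ : ℂ} {r m : ℝ} (hr : 0 < r)
    (hf : ∀ z, ‖z - z₀‖ ≤ r → DifferentiableAt ℂ f z) (h0 : ‖f z₀‖ < m)
    (hm : ∀ z, ‖z - z₀‖ = r → m ≤ ‖f z‖) : ∃ z, f z = 0 ∧ ‖z - z₀‖ ≤ r := by
  by_contra! hne
  have hm0 : 0 < m := (norm_nonneg _).trans_lt h0
  have hnz : ∀ z, ‖z - z₀‖ ≤ r → f z ≠ 0 := fun z hz h => (hne z h).not_ge hz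
  have hcl : closure (Metric.ball z₀ r) = Metric.closedBall z₀ r := closure_ball z₀ hr.ne'
  have hd : DiffContOnCl ℂ (fun z => (f z)⁻¹) (Metric.ball z₀ r) := by
    refine DifferentiableOn.diffContOnCl fun z hz => ?_
    rw [hcl, mem_closedBall_iff_norm] at hz
    exact ((hf z hz).inv (hnz z hz)).differentiableWithinAt
  have h1 := Complex.norm_le_of_forall_mem_frontier_norm_le Metric.isBounded_ball hd
    (C := m⁻¹) (fun z hz => by
      rw [frontier_ball z₀ hr.ne', mem_sphere_iff_norm] at hz
      rw [norm_inv]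
      exact inv_anti₀ hm0 (hm z hz)) (subset_closure (Metric.mem_ball_self hr))
  rw [norm_inv, inv_le_inv₀ (norm_pos_iff.2 (hnz z₀ (by simp [hr.le]))) hm0] at h1
  linarith

/-- An approximation to the ordinate of the first zero of `ζ` on the critical line. -/
noncomputable def nearZero : ℂ := ⟨1 / 2, 14.135⟩

/-- The factor of `5 ^ (-s)` in the Euler–Maclaurin main term. -/
noncomputable def emFactor (s : ℂ) : ℂ := 5 / (s - 1) + 1 / 2 + s / 60 - s * (s + 1) * (s + 2) / 90000

/-- The Euler–Maclaurin main term with cutoff `5`. -/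
noncomputable def emMain (s : ℂ) : ℂ :=
  1 + (2 : ℂ) ^ (-s) + (3 : ℂ) ^ (-s) + (4 : ℂ) ^ (-s) + (5 : ℂ) ^ (-s) * emFactor s

theorem abs_re_im_sub_nearZero {z : ℂ} (hz : ‖z - nearZero‖ ≤ 0.2) :
    0.3 ≤ z.re ∧ z.re ≤ 0.7 ∧ |z.im| ≤ 14.34 ∧ 13.9 ≤ z.im := by
  have h1 := (Complex.abs_re_le_norm _).trans hz
  have h2 := (Complex.abs_im_le_norm _).trans hz
  simp only [Complex.sub_re, Complex.sub_im, abs_le, nearZero] at h1 h2 ⊢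
  refine ⟨?_, ?_, ⟨?_, ?_⟩, ?_⟩ <;> linarith [h1.1, h1.2, h2.1, h2.2]

theorem norm_riemannZeta_sub_emMain_le {z : ℂ} (hz : ‖z - nearZero‖ ≤ 0.2) :
    ‖riemannZeta z - emMain z‖ ≤ 0.026 := by
  obtain ⟨h1, h2, h3, h4⟩ := abs_re_im_sub_nearZero hz
  have hs : 0 < z.re := by linarith
  have hs1 : z ≠ 1 := by rintro rfl; norm_num at h2
  have hb := norm_eulerMaclaurin_integral_le hs (N := 5) (by norm_num)
  have he := riemannZeta_eq_eulerMaclaurin hs hs1 (N := 5) (by norm_num)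
  generalize (∫ u in Ioi ((5 : ℕ) : ℝ),
    ((Int.fract u ^ 6 / 720 - Int.fract u ^ 5 / 240 + Int.fract u ^ 4 / 288 -
      Int.fract u ^ 2 / 1440 : ℝ) : ℂ) * (u : ℂ) ^ (-(z + 6))) = J at hb he
  have e : riemannZeta z - emMain z =
      -(z * (z + 1) * (z + 2) * (z + 3) * (z + 4) * (z + 5) * J) := by
    have hs2 : z - 1 ≠ 0 := sub_ne_zero.2 hs1
    have h5 : (5 : ℂ) ≠ 0 := by norm_num
    rw [he, emMain, emFactor]
    have c1 : (5 : ℂ) ^ (1 - z) = 5 * (5 : ℂ) ^ (-z) := by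
      rw [show 1 - z = 1 + -z by ring, Complex.cpow_add _ _ h5, Complex.cpow_one]
    have c2 : (5 : ℂ) ^ (-(z + 1)) = (5 : ℂ) ^ (-z) / 5 := by
      rw [show -(z + 1) = -z - 1 by ring, Complex.cpow_sub _ _ h5, Complex.cpow_one]
    have c3 : (5 : ℂ) ^ (-(z + 3)) = (5 : ℂ) ^ (-z) / 125 := by
      rw [show -(z + 3) = -z - (3 : ℕ) by push_cast; ring, Complex.cpow_sub _ _ h5,
        Complex.cpow_natCast]
      norm_num
    simp only [Finset.sum_Icc_succ_top, Nat.reduceAdd, Finset.Icc_self,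
      Finset.sum_singleton, Nat.cast_ofNat, Nat.cast_one, Complex.one_cpow, c1, c2, c3,
      Order.one_le_iff_pos, Nat.ofNat_pos]
    field_simp
    ring
  have hn : ∀ c B : ℝ, 0 ≤ c → 0 ≤ B → (0.7 + c) ^ 2 + 14.34 ^ 2 ≤ B ^ 2 → ‖z + c‖ ≤ B := by
    intro c B hc hB h
    refine norm_le_of_abs_re_le_of_abs_im_le (a := 0.7 + c) (b := 14.34) hB ?_ ?_ h
    · rw [Complex.add_re, Complex.ofReal_re, abs_le]; constructor <;> linarith
    · simpa using h3
  have b0 : ‖z‖ ≤ 14.36 := by simpa using hn 0 14.36 le_rfl (by norm_num) (by norm_num)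
  have b1 : ‖z + 1‖ ≤ 14.45 := by simpa using hn 1 14.45 (by norm_num) (by norm_num) (by norm_num)
  have b2 : ‖z + 2‖ ≤ 14.6 := by simpa using hn 2 14.6 (by norm_num) (by norm_num) (by norm_num)
  have b3 : ‖z + 3‖ ≤ 14.82 := by simpa using hn 3 14.82 (by norm_num) (by norm_num) (by norm_num)
  have b4 : ‖z + 4‖ ≤ 15.1 := by simpa using hn 4 15.1 (by norm_num) (by norm_num) (by norm_num)
  have b5 : ‖z + 5‖ ≤ 15.44 := by simpa using hn 5 15.44 (by norm_num) (by norm_num) (by norm_num)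
  have hp : (5 : ℝ) ^ (-(z.re + 5)) ≤ 1 / 5000 := by
    have p1 : (5 : ℝ) ^ (-(z.re + 5)) ≤ (5 : ℝ) ^ (-(5.3 : ℝ)) :=
      Real.rpow_le_rpow_of_exponent_le (by norm_num) (by linarith)
    have p2 : (1.6 : ℝ) ≤ (5 : ℝ) ^ (0.3 : ℝ) := by
      refine le_of_pow_le_pow_left₀ (n := 10) (by norm_num) (by positivity) ?_
      rw [← Real.rpow_natCast ((5 : ℝ) ^ (0.3 : ℝ)), ← Real.rpow_mul (by norm_num)]
      norm_num
    have p3 : (5 : ℝ) ^ (5.3 : ℝ) = 3125 * (5 : ℝ) ^ (0.3 : ℝ) := by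
      rw [show (5.3 : ℝ) = (5 : ℕ) + 0.3 by norm_num, Real.rpow_add (by norm_num),
        Real.rpow_natCast]
      norm_num
    refine p1.trans ?_
    rw [Real.rpow_neg (by norm_num), p3, one_div]
    exact inv_anti₀ (by norm_num) (by linarith)
  have hJ : ‖J‖ ≤ 1 / 15360 * (1 / 5000 / 5.3) := by
    refine hb.trans ?_
    push_cast
    gcongr
    linarith
  rw [e, norm_neg]
  simp only [norm_mul]
  calc _ ≤ (14.36 * 14.45 * 14.6 * 14.82 * 15.1 * 15.44 : ℝ) * (1 / 15360 * (1 / 5000 / 5.3)) := by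
        gcongr
    _ ≤ 0.026 := by norm_num

/-- The quadratic term gives 1/2 and the remainder at most (2/9)·0.33. The radius 0.33 is 0.2·1.65,
with 1.65 above log 5. -/
theorem norm_exp_sub_one_sub_le {x : ℂ} (hx : ‖x‖ ≤ 0.33) :
    ‖Complex.exp x - 1 - x‖ ≤ 0.575 * ‖x‖ ^ 2 := by
  have h := Complex.exp_bound (x := x) (hx.trans (by norm_num)) (n := 3) (by norm_num)
  simp only [Finset.sum_range_succ, Finset.sum_range_zero] at h
  norm_num at h
  have e : Complex.exp x - 1 - x = (Complex.exp x - (1 + x + x ^ 2 / 2)) + x ^ 2 / 2 := by ring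
  rw [e]
  refine (norm_add_le _ _).trans ?_
  have h2 : ‖x ^ 2 / 2‖ = ‖x‖ ^ 2 / 2 := by simp
  rw [h2]
  nlinarith [norm_nonneg x, sq_nonneg ‖x‖, mul_le_mul_of_nonneg_left hx (sq_nonneg ‖x‖)]

theorem natCast_cpow_neg_add {n : ℕ} (hn : 0 < n) (z h : ℂ) :
    (n : ℂ) ^ (-(z + h)) = (n : ℂ) ^ (-z) * Complex.exp (-(h * Real.log n)) := by
  have hnc : (n : ℂ) ≠ 0 := by exact_mod_cast hn.ne'
  rw [show -(z + h) = -z + -h by ring, Complex.cpow_add _ _ hnc, Complex.cpow_def_of_ne_zero hnc (-h),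
    Complex.natCast_log]
  ring_nf

theorem norm_exp_neg_mul_le {h : ℂ} {L B : ℝ} (hh : ‖h‖ ≤ 0.2) (hL : 0 ≤ L) (hLB : L ≤ B)
    (hB : B ≤ 1.65) :
    ‖Complex.exp (-(h * L)) - 1 - -(h * L)‖ ≤ 0.575 * B ^ 2 * ‖h‖ ^ 2 := by
  have h1 : ‖-(h * (L : ℂ))‖ = ‖h‖ * L := by
    rw [norm_neg, norm_mul, Complex.norm_real, Real.norm_of_nonneg hL]
  refine (norm_exp_sub_one_sub_le ?_).trans ?_
  · rw [h1]
    calc ‖h‖ * L ≤ 0.2 * 1.65 := by gcongr; linarith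
      _ = 0.33 := by norm_num
  · rw [h1, mul_pow]
    have : L ^ 2 ≤ B ^ 2 := by gcongr
    nlinarith [mul_le_mul_of_nonneg_left this (sq_nonneg ‖h‖)]

theorem norm_natCast_cpow_sub_le {n : ℕ} (hn : 0 < n) {h : ℂ} {B A : ℝ} (hh : ‖h‖ ≤ 0.2)
    (hLB : Real.log n ≤ B) (hB : B ≤ 1.65) (hA : ‖(n : ℂ) ^ (-nearZero)‖ ≤ A) :
    ‖(n : ℂ) ^ (-(nearZero + h)) - (n : ℂ) ^ (-nearZero) +
      h * (Real.log n * (n : ℂ) ^ (-nearZero))‖ ≤ A * (0.575 * B ^ 2) * ‖h‖ ^ 2 := by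
  rw [natCast_cpow_neg_add hn]
  have e : (n : ℂ) ^ (-nearZero) * Complex.exp (-(h * Real.log n)) - (n : ℂ) ^ (-nearZero) +
      h * (Real.log n * (n : ℂ) ^ (-nearZero)) = (n : ℂ) ^ (-nearZero) *
      (Complex.exp (-(h * Real.log n)) - 1 - -(h * Real.log n)) := by ring
  rw [e, norm_mul, mul_assoc]
  exact mul_le_mul hA (norm_exp_neg_mul_le hh (Real.log_natCast_nonneg n) hLB hB) (norm_nonneg _)
    ((norm_nonneg _).trans hA)

theorem norm_natCast_cpow_nearZero_le {n : ℕ} (hn : 0 < n) {A : ℝ} (hA : 0 < A)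
    (h : 1 ≤ A ^ 2 * n) : ‖(n : ℂ) ^ (-nearZero)‖ ≤ A := by
  have hn0 : (0 : ℝ) < n := by exact_mod_cast hn
  rw [Complex.norm_natCast_cpow_of_pos hn]
  have h1 : (-nearZero).re = -(1 / 2) := by simp [nearZero]
  rw [h1, Real.rpow_neg hn0.le, ← Real.sqrt_eq_rpow, inv_le_iff_one_le_mul₀ (by positivity)]
  have h2 : Real.sqrt (A ^ 2 * n) = A * Real.sqrt n := by
    rw [Real.sqrt_mul (sq_nonneg A), Real.sqrt_sq hA.le]
  rw [← h2]
  exact Real.one_le_sqrt.2 h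

/-- The derivative of `emFactor` at `nearZero`. -/
noncomputable def emFactorDeriv : ℂ :=
  -5 / (nearZero - 1) ^ 2 + 1 / 60 - (3 * nearZero ^ 2 + 6 * nearZero + 2) / 90000

theorem inv_nearZero_sub_one :
    (nearZero - 1)⁻¹ = ⟨-0.5 / 200.048225, -14.135 / 200.048225⟩ := by
  refine inv_eq_of_mul_eq_one_right ?_
  apply Complex.ext <;> simp [nearZero] <;> norm_num

theorem norm_emFactor_sub_le : ‖emFactor nearZero - ⟨0.5058, -0.08723⟩‖ ≤ 0.0001 := by
  refine norm_le_of_abs_re_le_of_abs_im_le (a := 0.00005) (b := 0.00005) (by norm_num) ?_ ?_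
    (by norm_num) <;>
  · rw [emFactor, div_eq_mul_inv, inv_nearZero_sub_one, abs_le]
    simp [nearZero]
    norm_num

theorem norm_emFactorDeriv_sub_le : ‖emFactorDeriv - ⟨0.0482, -0.0032⟩‖ ≤ 0.0001 := by
  refine norm_le_of_abs_re_le_of_abs_im_le (a := 0.00005) (b := 0.00005) (by norm_num) ?_ ?_
    (by norm_num) <;>
  · rw [emFactorDeriv, div_eq_mul_inv, ← inv_pow, inv_nearZero_sub_one, abs_le]
    simp [nearZero, pow_two]
    norm_num

theorem norm_emFactor_nearZero_le : ‖emFactor nearZero‖ ≤ 0.516 := by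
  have h : ‖(⟨0.5058, -0.08723⟩ : ℂ)‖ ≤ 0.5158 :=
    norm_le_of_abs_re_le_of_abs_im_le (a := 0.5058) (b := 0.08723) (by norm_num)
      (by norm_num [abs_le]) (by norm_num [abs_le]) (by norm_num)
  have := norm_add_le (emFactor nearZero - ⟨0.5058, -0.08723⟩) ⟨0.5058, -0.08723⟩
  rw [sub_add_cancel] at this
  linarith [norm_emFactor_sub_le]

theorem norm_emFactorDeriv_le : ‖emFactorDeriv‖ ≤ 0.05 := by
  have h : ‖(⟨0.0482, -0.0032⟩ : ℂ)‖ ≤ 0.0489 :=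
    norm_le_of_abs_re_le_of_abs_im_le (a := 0.0482) (b := 0.0032) (by norm_num)
      (by norm_num [abs_le]) (by norm_num [abs_le]) (by norm_num)
  have := norm_add_le (emFactorDeriv - ⟨0.0482, -0.0032⟩) ⟨0.0482, -0.0032⟩
  rw [sub_add_cancel] at this
  linarith [norm_emFactorDeriv_sub_le]

theorem norm_emFactor_taylor_le {h : ℂ} (hh : ‖h‖ ≤ 0.2) :
    ‖emFactor (nearZero + h) - emFactor nearZero - h * emFactorDeriv‖ ≤ 0.0024 * ‖h‖ ^ 2 := by
  have hz : ‖nearZero + h - nearZero‖ ≤ 0.2 := by simpa using hh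
  obtain ⟨-, -, -, h4⟩ := abs_re_im_sub_nearZero hz
  have hz0 : ‖nearZero - nearZero‖ ≤ 0.2 := by simp; norm_num
  obtain ⟨h5, h6, h7, h8⟩ := abs_re_im_sub_nearZero hz0
  have a1 : 13.9 ≤ ‖nearZero + h - 1‖ := by
    refine le_trans ?_ (Complex.abs_im_le_norm _)
    rw [Complex.sub_im, Complex.one_im, sub_zero]
    exact h4.trans (le_abs_self _)
  have a2 : 13.9 ≤ ‖nearZero - 1‖ := by
    refine le_trans ?_ (Complex.abs_im_le_norm _)
    rw [Complex.sub_im, Complex.one_im, sub_zero]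
    exact h8.trans (le_abs_self _)
  have a3 : ‖nearZero‖ ≤ 14.4 := norm_le_of_abs_re_le_of_abs_im_le (a := 0.7) (b := 14.34)
    (by norm_num) (by rw [abs_le]; constructor <;> linarith) h7 (by norm_num)
  have n1 : nearZero + h - 1 ≠ 0 := norm_pos_iff.1 (by linarith)
  have n2 : nearZero - 1 ≠ 0 := norm_pos_iff.1 (by linarith)
  have e : emFactor (nearZero + h) - emFactor nearZero - h * emFactorDeriv =
      (5 / ((nearZero - 1) ^ 2 * (nearZero + h - 1)) - (3 * nearZero + 3 + h) / 90000) * h ^ 2 := by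
    rw [emFactor, emFactor, emFactorDeriv]
    field_simp
    ring
  rw [e, norm_mul, norm_pow]
  refine mul_le_mul_of_nonneg_right ((norm_sub_le _ _).trans ?_) (by positivity)
  have t1 : ‖5 / ((nearZero - 1) ^ 2 * (nearZero + h - 1))‖ ≤ 5 / (13.9 ^ 2 * 13.9) := by
    rw [norm_div, norm_mul, norm_pow, Complex.norm_ofNat]
    gcongr
  have t2 : ‖(3 * nearZero + 3 + h) / 90000‖ ≤ (3 * 14.4 + 3 + 0.2) / 90000 := by
    rw [norm_div, Complex.norm_ofNat]
    gcongr
    refine (norm_add_le _ _).trans (add_le_add ((norm_add_le _ _).trans (add_le_add ?_ ?_)) hh)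
    · rw [norm_mul, Complex.norm_ofNat]; gcongr
    · rw [Complex.norm_ofNat]
  refine (add_le_add t1 t2).trans (by norm_num)

/-- The derivative of `emMain` at `nearZero`. -/
noncomputable def emMainDeriv : ℂ :=
  -(Real.log 2 * (2 : ℂ) ^ (-nearZero)) - Real.log 3 * (3 : ℂ) ^ (-nearZero) -
    Real.log 4 * (4 : ℂ) ^ (-nearZero) +
    (5 : ℂ) ^ (-nearZero) * (emFactorDeriv - Real.log 5 * emFactor nearZero)

theorem norm_emMain_taylor_le {h : ℂ} (hh : ‖h‖ ≤ 0.2) :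
    ‖emMain (nearZero + h) - emMain nearZero - h * emMainDeriv‖ ≤ 1.54 * ‖h‖ ^ 2 := by
  have l2 := Real.log_two_lt_d9
  have l3 := Real.log_three_lt_d9
  have l5 := Real.log_five_lt_d9
  have t2 := norm_natCast_cpow_sub_le (n := 2) (by norm_num) hh (B := 0.6932)
    (by push_cast; linarith) (by norm_num)
    (norm_natCast_cpow_nearZero_le (A := 0.708) (by norm_num) (by norm_num) (by norm_num))
  have t3 := norm_natCast_cpow_sub_le (n := 3) (by norm_num) hh (B := 1.0987)
    (by push_cast; linarith) (by norm_num)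
    (norm_natCast_cpow_nearZero_le (A := 0.578) (by norm_num) (by norm_num) (by norm_num))
  have t4 := norm_natCast_cpow_sub_le (n := 4) (by norm_num) hh (B := 1.3863)
    (by push_cast; rw [Real.log_four_eq]; linarith) (by norm_num)
    (norm_natCast_cpow_nearZero_le (A := 0.5) (by norm_num) (by norm_num) (by norm_num))
  have w5 := norm_natCast_cpow_nearZero_le (n := 5) (by norm_num) (A := 0.4473) (by norm_num)
    (by norm_num)
  have hL5 : 0 ≤ Real.log 5 := Real.log_nonneg (by norm_num)
  have t5 := norm_exp_neg_mul_le hh hL5 (B := 1.6095) (by linarith) (by norm_num)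
  have tR := norm_emFactor_taylor_le hh
  have c5 := natCast_cpow_neg_add (n := 5) (by norm_num) nearZero h
  push_cast at t2 t3 t4 w5 c5
  set w := (5 : ℂ) ^ (-nearZero)
  set R := emFactor nearZero
  set ε := Complex.exp (-(h * Real.log 5)) - 1 - -(h * Real.log 5) with hε
  set ρ := emFactor (nearZero + h) - R - h * emFactorDeriv with hρ
  have hq : 0 ≤ ‖h‖ ^ 2 := by positivity
  have hq2 : ‖h‖ ^ 2 ≤ 0.04 := by nlinarith [norm_nonneg h]
  -- The product rule with exact remainders: ε for the exponential, ρ for the factor. Every term on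
  -- the right is of second order in h.
  have e5 : (5 : ℂ) ^ (-(nearZero + h)) * emFactor (nearZero + h) - w * R -
      h * (w * (emFactorDeriv - Real.log 5 * R)) =
      w * (ε * (R + h * emFactorDeriv + ρ) - h * Real.log 5 * (h * emFactorDeriv + ρ) + ρ) := by
    rw [c5, hε, hρ]; ring
  have b1 : ‖h * emFactorDeriv‖ ≤ ‖h‖ * 0.05 := by
    rw [norm_mul]; gcongr; exact norm_emFactorDeriv_le
  have b2 : ‖R + h * emFactorDeriv + ρ‖ ≤ 0.5262 := by
    refine (norm_add₃_le).trans ?_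
    linarith [norm_emFactor_nearZero_le]
  have b3 : ‖h * emFactorDeriv + ρ‖ ≤ ‖h‖ * 0.0505 := by
    refine (norm_add_le _ _).trans ?_
    nlinarith [norm_nonneg h]
  have b4 : ‖h * (Real.log 5 : ℂ)‖ ≤ ‖h‖ * 1.6095 := by
    rw [norm_mul, Complex.norm_real, Real.norm_of_nonneg hL5]
    gcongr; linarith
  have b5 : ‖w * (ε * (R + h * emFactorDeriv + ρ) - h * Real.log 5 * (h * emFactorDeriv + ρ) + ρ)‖ ≤
      0.4473 * ((0.575 * 1.6095 ^ 2 * ‖h‖ ^ 2) * 0.5262 + (‖h‖ * 1.6095) * (‖h‖ * 0.0505) +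
        0.0024 * ‖h‖ ^ 2) := by
    rw [norm_mul]
    refine mul_le_mul w5 ?_ (norm_nonneg _) (by norm_num)
    refine (norm_add_le _ _).trans (add_le_add ((norm_sub_le _ _).trans (add_le_add ?_ ?_)) tR)
    · rw [norm_mul]; gcongr
    · rw [norm_mul]; gcongr
  rw [← e5] at b5
  have e : emMain (nearZero + h) - emMain nearZero - h * emMainDeriv =
      ((2 : ℂ) ^ (-(nearZero + h)) - (2 : ℂ) ^ (-nearZero) +
        h * (Real.log 2 * (2 : ℂ) ^ (-nearZero))) +
      ((3 : ℂ) ^ (-(nearZero + h)) - (3 : ℂ) ^ (-nearZero) +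
        h * (Real.log 3 * (3 : ℂ) ^ (-nearZero))) +
      ((4 : ℂ) ^ (-(nearZero + h)) - (4 : ℂ) ^ (-nearZero) +
        h * (Real.log 4 * (4 : ℂ) ^ (-nearZero))) +
      ((5 : ℂ) ^ (-(nearZero + h)) * emFactor (nearZero + h) - w * R -
        h * (w * (emFactorDeriv - Real.log 5 * R))) := by
    rw [emMain, emMain, emMainDeriv]; ring
  rw [e]
  refine (norm_add_le _ _).trans ((add_le_add ((norm_add_le _ _).trans
    (add_le_add ((norm_add_le _ _).trans (add_le_add t2 t3)) t4)) b5).trans ?_)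
  nlinarith

/-! ### Numerical values at the centre. -/

theorem norm_exp_mul_I_sub_le {x : ℝ} (hx : |x| ≤ 0.8) :
    ‖Complex.exp (-(x * Complex.I)) - ⟨1 - x ^ 2 / 2 + x ^ 4 / 24 - x ^ 6 / 720,
      -(x - x ^ 3 / 6 + x ^ 5 / 120 - x ^ 7 / 5040)⟩‖ ≤ 0.00001 := by
  have hn : ‖-((x : ℂ) * Complex.I)‖ = |x| := by
    rw [norm_neg, norm_mul, Complex.norm_I, mul_one, Complex.norm_real, Real.norm_eq_abs]
  have h := Complex.exp_bound (x := -((x : ℂ) * Complex.I)) (by rw [hn]; linarith) (n := 8)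
    (by norm_num)
  rw [hn] at h
  have e : ∑ m ∈ Finset.range 8, (-((x : ℂ) * Complex.I)) ^ m / (m.factorial : ℂ) =
      ⟨1 - x ^ 2 / 2 + x ^ 4 / 24 - x ^ 6 / 720,
      -(x - x ^ 3 / 6 + x ^ 5 / 120 - x ^ 7 / 5040)⟩ := by
    have I2 := Complex.I_sq
    have I3 : Complex.I ^ 3 = -Complex.I := Complex.I_pow_three
    have I4 : Complex.I ^ 4 = 1 := Complex.I_pow_four
    have I5 : Complex.I ^ 5 = Complex.I := by rw [pow_succ, I4, one_mul]
    have I6 : Complex.I ^ 6 = -1 := by rw [pow_succ, I5, Complex.I_mul_I]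
    have I7 : Complex.I ^ 7 = -Complex.I := by rw [pow_succ, I6]; ring
    rw [Complex.mk_eq_add_mul_I]
    simp only [Finset.sum_range_succ, Finset.sum_range_zero, neg_pow ((x : ℂ) * Complex.I), mul_pow,
      I2, I3, I4, I5, I6, I7, Nat.factorial]
    push_cast
    ring
  rw [e] at h
  refine h.trans ?_
  have : |x| ^ 8 ≤ 0.8 ^ 8 := by gcongr
  norm_num [Nat.factorial] at this ⊢
  linarith

/-- Subtracting an odd multiple kπ from the phase 14.135 log n leaves a small angle near q and a
sign -1. Hence the value is close to -r cos q + i r sin q with r near n^(-1/2), and short Taylor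
polynomials suffice. -/
theorem norm_natCast_cpow_nearZero_sub_le {n k : ℕ} (hn : 0 < n) (hk : Odd k) {q r : ℝ} {a b : ℝ}
    (hq : |q| ≤ 0.8) (hr0 : 0 < r) (hr1 : r ≤ 1) 
    (hθ : |14.135 * Real.log n - k * Real.pi - q| ≤ 0.00001)
    (hrl : (r - 0.00001) ^ 2 * n ≤ 1) (hru : 1 ≤ (r + 0.00001) ^ 2 * n)
    (ha : |a + r * (1 - q ^ 2 / 2 + q ^ 4 / 24 - q ^ 6 / 720)| ≤ 0.00001)
    (hb : |b - r * (q - q ^ 3 / 6 + q ^ 5 / 120 - q ^ 7 / 5040)| ≤ 0.00001) :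
    ‖(n : ℂ) ^ (-nearZero) - ⟨a, b⟩‖ ≤ 0.0001 := by
  have hn0 : (0 : ℝ) < n := by exact_mod_cast hn
  have hnc : (n : ℂ) ≠ 0 := by exact_mod_cast hn.ne'
  set φ : ℝ := 14.135 * Real.log n - k * Real.pi with hφ
  set s : ℝ := (Real.sqrt n)⁻¹ with hs
  have hs0 : 0 < s := by positivity
  have hssq : s ^ 2 * n = 1 := by
    rw [hs, inv_pow, Real.sq_sqrt hn0.le, inv_mul_cancel₀ hn0.ne']
  have hsr : |s - r| ≤ 0.00001 := by
    rw [abs_le]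
    constructor
    · by_contra! h
      have : s ^ 2 < (r - 0.00001) ^ 2 := by
        apply pow_lt_pow_left₀ <;> linarith
      nlinarith
    · by_contra! h
      have : (r + 0.00001) ^ 2 < s ^ 2 := by
        apply pow_lt_pow_left₀ <;> linarith
      nlinarith
  have hw : (n : ℂ) ^ (-nearZero) = -(s * Complex.exp (-(φ * Complex.I))) := by
    have h1 : nearZero = ((1 / 2 : ℝ) : ℂ) + ((14.135 : ℝ) : ℂ) * Complex.I := by
      rw [nearZero, Complex.mk_eq_add_mul_I]
    have h2 : (n : ℂ) ^ (-((1 / 2 : ℝ) : ℂ)) = s := by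
      rw [← Complex.ofReal_natCast, ← Complex.ofReal_neg, ← Complex.ofReal_cpow hn0.le,
        Real.rpow_neg hn0.le, ← Real.sqrt_eq_rpow]
    have h3 : Complex.exp (-((k * Real.pi : ℝ) * Complex.I)) = -1 := by
      have h4 : Complex.exp (Real.pi * Complex.I) ^ k = -1 := by
        rw [Complex.exp_pi_mul_I]; exact hk.neg_one_pow
      rw [Complex.exp_neg, Complex.ofReal_mul, Complex.ofReal_natCast, mul_assoc,
        Complex.exp_nat_mul, h4]
      norm_num
    rw [h1, neg_add, Complex.cpow_add _ _ hnc, h2, Complex.cpow_def_of_ne_zero hnc]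
    have h5 : (Real.log n : ℂ) * -(((14.135 : ℝ) : ℂ) * Complex.I) =
        -((k * Real.pi : ℝ) * Complex.I) + -(φ * Complex.I) := by
      rw [hφ]; push_cast; ring
    rw [← Complex.natCast_log, h5, Complex.exp_add, h3]
    ring
  set T : ℂ := ⟨1 - q ^ 2 / 2 + q ^ 4 / 24 - q ^ 6 / 720,
      -(q - q ^ 3 / 6 + q ^ 5 / 120 - q ^ 7 / 5040)⟩ with hT
  have h1 : ‖Complex.exp (-(φ * Complex.I)) - Complex.exp (-(q * Complex.I))‖ ≤ 0.00001 := by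
    have e : Complex.exp (-(φ * Complex.I)) - Complex.exp (-(q * Complex.I)) =
        Complex.exp (((-q : ℝ) : ℂ) * Complex.I) *
          (Complex.exp (Complex.I * ((q - φ : ℝ) : ℂ)) - 1) := by
      rw [mul_sub, ← Complex.exp_add, mul_one]
      push_cast; ring_nf
    rw [e, norm_mul, Complex.norm_exp_ofReal_mul_I, one_mul]
    refine (Real.norm_exp_I_mul_ofReal_sub_one_le).trans ?_
    rw [Real.norm_eq_abs, abs_sub_comm]; exact hθ
  have h2 := norm_exp_mul_I_sub_le hq
  have h3 : ‖(r : ℂ) * T + ⟨a, b⟩‖ ≤ 0.00002 := by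
    refine norm_le_of_abs_re_le_of_abs_im_le (a := 0.00001) (b := 0.00001) (by norm_num) ?_ ?_
      (by norm_num)
    · simp only [hT, Complex.add_re, Complex.re_ofReal_mul]
      rwa [add_comm]
    · simp only [hT, Complex.add_im, Complex.im_ofReal_mul]
      rwa [mul_neg, neg_add_eq_sub]
  have e : (n : ℂ) ^ (-nearZero) - ⟨a, b⟩ =
      -((s - r : ℝ) * Complex.exp (((-φ : ℝ) : ℂ) * Complex.I)) -
      r * (Complex.exp (-(φ * Complex.I)) - Complex.exp (-(q * Complex.I))) -
      r * (Complex.exp (-(q * Complex.I)) - T) - (r * T + ⟨a, b⟩) := by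
    rw [hw]; push_cast; ring_nf
  have hrn : ‖(r : ℂ)‖ ≤ 1 := by rwa [Complex.norm_real, Real.norm_of_nonneg hr0.le]
  rw [e]
  refine (norm_sub_le _ _).trans ((add_le_add ((norm_sub_le _ _).trans (add_le_add
    ((norm_sub_le _ _).trans (add_le_add (b := 0.00001) (d := 0.00001) ?_ ?_)) (d := 0.00001) ?_))
    h3).trans (by norm_num))
  · rw [norm_neg, norm_mul, Complex.norm_exp_ofReal_mul_I, mul_one, Complex.norm_real]
    exact hsr
  · rw [norm_mul]
    exact (mul_le_mul hrn h1 (norm_nonneg _) zero_le_one).trans (by norm_num)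
  · rw [norm_mul]
    exact (mul_le_mul hrn h2 (norm_nonneg _) zero_le_one).trans (by norm_num)

theorem norm_two_cpow_nearZero_sub_le :
    ‖(2 : ℂ) ^ (-nearZero) - ⟨-0.658522, 0.257583⟩‖ ≤ 0.0001 := by
  have h1 := Real.log_two_gt_d9
  have h2 := Real.log_two_lt_d9
  have h3 := Real.pi_gt_d20
  have h4 := Real.pi_lt_d20
  refine norm_natCast_cpow_nearZero_sub_le (n := 2) (k := 3) (q := 0.372857) (r := 0.707107)
    (by norm_num) (by decide) (by norm_num [abs_le]) (by norm_num) (by norm_num) ?_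
    (by norm_num) (by norm_num) (by norm_num [abs_le]) (by norm_num [abs_le])
  rw [abs_le]; push_cast; constructor <;> linarith

theorem norm_three_cpow_nearZero_sub_le :
    ‖(3 : ℂ) ^ (-nearZero) - ⟨-0.568117, -0.102839⟩‖ ≤ 0.0001 := by
  have h1 := Real.log_three_gt_d9
  have h2 := Real.log_three_lt_d9
  have h3 := Real.pi_gt_d20
  have h4 := Real.pi_lt_d20
  refine norm_natCast_cpow_nearZero_sub_le (n := 3) (k := 5) (q := -0.179079) (r := 0.577350)
    (by norm_num) (by decide) (by norm_num [abs_le]) (by norm_num) (by norm_num) ?_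
    (by norm_num) (by norm_num) (by norm_num [abs_le]) (by norm_num [abs_le])
  rw [abs_le]; push_cast; constructor <;> linarith

theorem norm_five_cpow_nearZero_sub_le :
    ‖(5 : ℂ) ^ (-nearZero) - ⟨-0.324693, 0.307529⟩‖ ≤ 0.0001 := by
  have h1 := Real.log_five_gt_d9
  have h2 := Real.log_five_lt_d9
  have h3 := Real.pi_gt_d20
  have h4 := Real.pi_lt_d20
  refine norm_natCast_cpow_nearZero_sub_le (n := 5) (k := 7) (q := 0.758256) (r := 0.447214)
    (by norm_num) (by decide) (by norm_num [abs_le]) (by norm_num) (by norm_num) ?_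
    (by norm_num) (by norm_num) (by norm_num [abs_le]) (by norm_num [abs_le])
  rw [abs_le]; push_cast; constructor <;> linarith

theorem norm_mul_sub_mul_le {a b c d : ℂ} {A D e f : ℝ} (ha : ‖a‖ ≤ A) (hd : ‖d‖ ≤ D)
    (h1 : ‖a - c‖ ≤ e) (h2 : ‖b - d‖ ≤ f) : ‖a * b - c * d‖ ≤ A * f + e * D := by
  rw [show a * b - c * d = a * (b - d) + (a - c) * d by ring]
  refine (norm_add_le _ _).trans ?_
  rw [norm_mul, norm_mul]
  exact add_le_add (mul_le_mul ha h2 (norm_nonneg _) ((norm_nonneg _).trans ha))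
    (mul_le_mul h1 hd (norm_nonneg _) ((norm_nonneg _).trans h1))

theorem norm_four_cpow_nearZero_sub_le :
    ‖(4 : ℂ) ^ (-nearZero) - ⟨-0.658522, 0.257583⟩ ^ 2‖ ≤ 0.0002 := by
  have h := norm_two_cpow_nearZero_sub_le
  have hw := norm_natCast_cpow_nearZero_le (n := 2) (A := 0.708) (by norm_num) (by norm_num)
    (by norm_num)
  have hv : ‖(⟨-0.658522, 0.257583⟩ : ℂ)‖ ≤ 0.8 :=
    norm_le_of_abs_re_le_of_abs_im_le (a := 0.658522) (b := 0.257583) (by norm_num)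
      (by norm_num [abs_le]) (by norm_num [abs_le]) (by norm_num)
  have e : (4 : ℂ) ^ (-nearZero) = (2 : ℂ) ^ (-nearZero) * (2 : ℂ) ^ (-nearZero) := by
    have := Complex.natCast_mul_natCast_cpow 2 2 (-nearZero)
    push_cast at this
    rw [← this]; norm_num
  push_cast at hw
  rw [e, sq]
  exact (norm_mul_sub_mul_le hw hv h h).trans (by norm_num)

theorem norm_emMain_nearZero_le : ‖emMain nearZero‖ ≤ 0.006 := by
  have h2 := norm_two_cpow_nearZero_sub_le
  have h3 := norm_three_cpow_nearZero_sub_le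
  have h4 := norm_four_cpow_nearZero_sub_le
  have hw := norm_natCast_cpow_nearZero_le (n := 5) (A := 0.4473) (by norm_num) (by norm_num)
    (by norm_num)
  have hR : ‖(⟨0.5058, -0.08723⟩ : ℂ)‖ ≤ 0.6 :=
    norm_le_of_abs_re_le_of_abs_im_le (a := 0.5058) (b := 0.08723) (by norm_num)
      (by norm_num [abs_le]) (by norm_num [abs_le]) (by norm_num)
  push_cast at hw
  have h5 := norm_mul_sub_mul_le hw hR norm_five_cpow_nearZero_sub_le norm_emFactor_sub_le
  have h0 : ‖1 + (⟨-0.658522, 0.257583⟩ : ℂ) + ⟨-0.568117, -0.102839⟩ +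
      ⟨-0.658522, 0.257583⟩ ^ 2 + ⟨-0.324693, 0.307529⟩ * ⟨0.5058, -0.08723⟩‖ ≤ 0.005 := by
    refine norm_le_of_abs_re_le_of_abs_im_le (a := 0.004) (b := 0.002) (by norm_num) ?_ ?_
      (by norm_num) <;>
    · rw [abs_le]
      simp [sq]
      norm_num
  set v : ℂ := 1 + (⟨-0.658522, 0.257583⟩ : ℂ) + ⟨-0.568117, -0.102839⟩ +
      ⟨-0.658522, 0.257583⟩ ^ 2 + ⟨-0.324693, 0.307529⟩ * ⟨0.5058, -0.08723⟩ with hv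
  have e : emMain nearZero = ((2 : ℂ) ^ (-nearZero) - ⟨-0.658522, 0.257583⟩) +
      ((3 : ℂ) ^ (-nearZero) - ⟨-0.568117, -0.102839⟩) +
      ((4 : ℂ) ^ (-nearZero) - ⟨-0.658522, 0.257583⟩ ^ 2) +
      ((5 : ℂ) ^ (-nearZero) * emFactor nearZero -
        ⟨-0.324693, 0.307529⟩ * ⟨0.5058, -0.08723⟩) + v := by
    rw [emMain, hv]; ring
  rw [e]
  refine (norm_add_le _ _).trans ((add_le_add ((norm_add_le _ _).trans (add_le_add
    ((norm_add_le _ _).trans (add_le_add ((norm_add_le _ _).trans (add_le_add h2 h3)) h4)) h5))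
    h0).trans (by norm_num))

theorem le_norm_emMainDeriv : 0.7 ≤ ‖emMainDeriv‖ := by
  have a1 := Real.log_two_gt_d9
  have a2 := Real.log_two_lt_d9
  have a3 := Real.log_three_gt_d9
  have a4 := Real.log_three_lt_d9
  have a5 := Real.log_five_gt_d9
  have a6 := Real.log_five_lt_d9
  have hL : ∀ {L B : ℝ} {z : ℂ} {e : ℝ}, 0 ≤ L → L ≤ B → ‖z‖ ≤ e → ‖(L : ℂ) * z‖ ≤ B * e := by
    intro L B z e h0 h1 h2
    rw [norm_mul, Complex.norm_real, Real.norm_of_nonneg h0]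
    exact mul_le_mul h1 h2 (norm_nonneg _) (h0.trans h1)
  have l4 : Real.log 4 = 2 * Real.log 2 := Real.log_four_eq
  have h2 := hL (by linarith) (by linarith : Real.log 2 ≤ 1) norm_two_cpow_nearZero_sub_le
  have h3 := hL (by linarith) (by linarith : Real.log 3 ≤ 2) norm_three_cpow_nearZero_sub_le
  have h4 := hL (by linarith) (by linarith : Real.log 4 ≤ 2) norm_four_cpow_nearZero_sub_le
  have h5 := hL (by linarith) (by linarith : Real.log 5 ≤ 2) norm_emFactor_sub_le
  have h6 : ‖(emFactorDeriv - Real.log 5 * emFactor nearZero) -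
      (⟨0.0482, -0.0032⟩ - Real.log 5 * ⟨0.5058, -0.08723⟩)‖ ≤ 0.0003 := by
    have e : (emFactorDeriv - Real.log 5 * emFactor nearZero) -
      ((⟨0.0482, -0.0032⟩ : ℂ) - Real.log 5 * ⟨0.5058, -0.08723⟩) =
      (emFactorDeriv - ⟨0.0482, -0.0032⟩) -
        (Real.log 5 : ℂ) * (emFactor nearZero - ⟨0.5058, -0.08723⟩) := by ring
    rw [e]
    exact (norm_sub_le _ _).trans ((add_le_add norm_emFactorDeriv_sub_le h5).trans (by norm_num))
  have hw := norm_natCast_cpow_nearZero_le (n := 5) (A := 0.4473) (by norm_num) (by norm_num)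
    (by norm_num)
  push_cast at hw
  have hX : ‖(⟨0.0482, -0.0032⟩ : ℂ) - Real.log 5 * ⟨0.5058, -0.08723⟩‖ ≤ 1 := by
    refine norm_le_of_abs_re_le_of_abs_im_le (a := 0.8) (b := 0.2) (by norm_num) ?_ ?_
      (by norm_num)
    · rw [Complex.sub_re, Complex.re_ofReal_mul, abs_le]
      constructor <;> norm_num <;> linarith
    · rw [Complex.sub_im, Complex.im_ofReal_mul, abs_le]
      constructor <;> norm_num <;> linarith
  have h7 := norm_mul_sub_mul_le hw hX norm_five_cpow_nearZero_sub_le h6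
  set V : ℂ := -((Real.log 2 : ℂ) * ⟨-0.658522, 0.257583⟩) -
    (Real.log 3 : ℂ) * ⟨-0.568117, -0.102839⟩ -
    (Real.log 4 : ℂ) * ⟨-0.658522, 0.257583⟩ ^ 2 +
    ⟨-0.324693, 0.307529⟩ * ((⟨0.0482, -0.0032⟩ : ℂ) - Real.log 5 * ⟨0.5058, -0.08723⟩) with hV
  -- The real part alone is large enough, and it is linear in the logarithms.
  have hVre : 0.75 ≤ ‖V‖ := by
    refine le_trans ?_ ((le_abs_self _).trans (Complex.abs_re_le_norm _))
    rw [hV, l4, sq]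
    simp only [Complex.add_re, Complex.sub_re, Complex.neg_re, Complex.mul_re,
      Complex.sub_im, Complex.im_ofReal_mul, Complex.ofReal_re, Complex.ofReal_im]
    linarith
  have e : emMainDeriv - V =
      -((Real.log 2 : ℂ) * ((2 : ℂ) ^ (-nearZero) - ⟨-0.658522, 0.257583⟩)) -
      (Real.log 3 : ℂ) * ((3 : ℂ) ^ (-nearZero) - ⟨-0.568117, -0.102839⟩) -
      (Real.log 4 : ℂ) * ((4 : ℂ) ^ (-nearZero) - ⟨-0.658522, 0.257583⟩ ^ 2) +
      ((5 : ℂ) ^ (-nearZero) * (emFactorDeriv - Real.log 5 * emFactor nearZero) -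
        ⟨-0.324693, 0.307529⟩ * ((⟨0.0482, -0.0032⟩ : ℂ) - Real.log 5 * ⟨0.5058, -0.08723⟩)) := by
    rw [emMainDeriv, hV]; ring
  have hd : ‖emMainDeriv - V‖ ≤ 0.01 := by
    rw [e]
    refine (norm_add_le _ _).trans ((add_le_add ((norm_sub_le _ _).trans (add_le_add
      ((norm_sub_le _ _).trans (add_le_add ((norm_neg _).le.trans h2) h3)) h4)) h7).trans
      (by norm_num))
  have := norm_sub_norm_le V emMainDeriv
  rw [norm_sub_rev] at this
  linarith

/-! ### A zero of small height and the explicit lower bound. -/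

theorem exists_riemannZeta_eq_zero_near :
    ∃ ρ : ℂ, riemannZeta ρ = 0 ∧ ‖ρ - nearZero‖ ≤ 0.2 := by
  have h0 : ‖nearZero - nearZero‖ ≤ 0.2 := by simp; norm_num
  -- At the centre |ζ| ≤ 0.026 + 0.006 = 0.032. On the circle |ζ| ≥ 0.2·0.7 - 1.54·0.2² - 0.026 -
  -- 0.006 = 0.0464. The threshold 0.04 separates them.
  refine exists_eq_zero_of_norm_lt_on_sphere (m := 0.04) (by norm_num) (fun z hz => ?_) ?_
    fun z hz => ?_
  · refine differentiableAt_riemannZeta ?_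
    rintro rfl
    obtain ⟨-, -, -, h⟩ := abs_re_im_sub_nearZero hz
    norm_num at h
  · have := norm_add_le (riemannZeta nearZero - emMain nearZero) (emMain nearZero)
    rw [sub_add_cancel] at this
    linarith [norm_riemannZeta_sub_emMain_le h0, norm_emMain_nearZero_le]
  · have hT := norm_emMain_taylor_le hz.le
    have hE := norm_riemannZeta_sub_emMain_le hz.le
    rw [add_sub_cancel, hz] at hT
    have hD : 0.2 * 0.7 ≤ ‖(z - nearZero) * emMainDeriv‖ := by
      rw [norm_mul, hz]; gcongr; exact le_norm_emMainDeriv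
    have e : (z - nearZero) * emMainDeriv = riemannZeta z - (riemannZeta z - emMain z) -
        emMain nearZero - (emMain z - emMain nearZero - (z - nearZero) * emMainDeriv) := by ring
    have h1 := norm_sub_le (riemannZeta z - (riemannZeta z - emMain z) - emMain nearZero)
      (emMain z - emMain nearZero - (z - nearZero) * emMainDeriv)
    have h2 := norm_sub_le (riemannZeta z - (riemannZeta z - emMain z)) (emMain nearZero)
    have h3 := norm_sub_le (riemannZeta z) (riemannZeta z - emMain z)
    rw [← e] at h1
    linarith [norm_emMain_nearZero_le]

theorem exists_riemannZeta_eq_zero_half_le_re :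
    ∃ ρ : ℂ, riemannZeta ρ = 0 ∧ 1 / 2 ≤ ρ.re ∧ ρ.re ≤ 0.7 ∧ |ρ.im| ≤ 14.34 := by
  obtain ⟨ρ, hρ, hd⟩ := exists_riemannZeta_eq_zero_near
  obtain ⟨h1, h1', h2, h2'⟩ := abs_re_im_sub_nearZero hd
  rcases le_or_gt (1 / 2) ρ.re with h | h
  · exact ⟨ρ, hρ, h, h1', h2⟩
  -- A zero left of the critical line is reflected by the functional equation, keeping |Im ρ|.
  · refine ⟨1 - ρ, ?_, by simp; linarith, by simp; linarith, by
      rwa [Complex.sub_im, Complex.one_im, zero_sub, abs_neg]⟩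
    rw [riemannZeta_one_sub (fun n hn => ?_) (fun hn => ?_), hρ, mul_zero]
    · rw [hn] at h2'; simp at h2'; linarith
    · rw [hn] at h2'; simp at h2'; linarith

theorem integral_abs_mobM_ge_sqrt {x : ℝ} (hx : 1 ≤ x) :
    (0.0025 : ℝ) * (Real.sqrt x - 1 / x) ≤ ∫ t in (1 : ℝ)..x, |mobM t| := by
  obtain ⟨ρ, hρ, h1, h2, h3⟩ := exists_riemannZeta_eq_zero_half_le_re
  have hρ1 : ρ ≠ 1 := by rintro rfl; exact riemannZeta_one_ne_zero hρ
  have hre : 0 < ρ.re := by linarith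
  have n1 : ‖ρ‖ ≤ 14.4 := norm_le_of_abs_re_le_of_abs_im_le (a := 0.7) (b := 14.34)
    (by norm_num)
    (by rw [abs_of_pos hre]; exact h2) h3 (by norm_num)
  have n2 : ‖ρ - 1‖ ≤ 14.4 := norm_le_of_abs_re_le_of_abs_im_le (a := 0.7) (b := 14.34)
    (by norm_num)
    (by rw [abs_le, Complex.sub_re, Complex.one_re]; constructor <;> linarith)
    (by simpa using h3) (by norm_num)
  have n3 : ‖ρ‖ / ρ.re ≤ 28.8 := by
    rw [div_le_iff₀ hre]; linarith
  -- Here 400 = 1/0.0025. The uncentred constant, bounded in the same way, would be 1 + 14.4·28.8 >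
  -- 400.
  have hC : 1 + ‖ρ - 1‖ * (1 / 2 + 1 / 2 * (‖ρ‖ / ρ.re)) ≤ 400 := by
    have : ‖ρ - 1‖ * (1 / 2 + 1 / 2 * (‖ρ‖ / ρ.re)) ≤ 14.4 * (1 / 2 + 1 / 2 * 28.8) := by gcongr
    linarith
  have h4 := rpow_sub_le_of_riemannZeta_eq_zero hρ
    (fun y hy => (norm_mobKernel_sub_le_half hre hρ1 hy).trans hC) hx
  have h5 : Real.sqrt x ≤ x ^ ρ.re := by
    rw [Real.sqrt_eq_rpow]; exact Real.rpow_le_rpow_of_exponent_le hx h1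
  linarith

theorem mainTheorem2 :
    -- lower bound attached to an arbitrary zero of zeta
    (∀ ρ : ℂ, riemannZeta ρ = 0 → ∀ x : ℝ, 1 ≤ x →
      (1 + ‖ρ - 1‖ * ‖ρ‖ / |ρ.re|)⁻¹ * (x ^ ρ.re - 1 / x) ≤ ∫ t in (1 : ℝ)..x, |mobM t|) ∧
    -- explicit lower bound
    (∀ x : ℝ, 1 ≤ x →
      (0.0025 : ℝ) * (Real.sqrt x - 1 / x) ≤ ∫ t in (1 : ℝ)..x, |mobM t|) ∧
    -- zeros on the line `Re s = 1` when `|m(x)| ≤ ε + o(1)`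
    (∀ ρ : ℂ, riemannZeta ρ = 0 → ρ.re = 1 → ∀ ε : ℝ, 0 < ε →
      (∃ r : ℝ → ℝ, Asymptotics.IsLittleO Filter.atTop r (fun _ => (1 : ℝ)) ∧
        ∀ᶠ x in Filter.atTop, |mobM x| ≤ ε + r x) →
      1 / Real.sqrt ε - 1 ≤ |ρ.im|) ∧
    -- `m(x) = o(1)` entails non-vanishing on the line `Re s = 1`
    (Asymptotics.IsLittleO Filter.atTop mobM (fun _ => (1 : ℝ)) →
      ∀ s : ℂ, s.re = 1 → riemannZeta s ≠ 0) ∧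
    -- partial sums on the line `Re s = 1`, for all `x ≥ 1`
    (∀ t : ℝ, t ≠ 0 → ∀ x : ℝ, 1 ≤ x →
      ‖mobDirichlet (1 + t * Complex.I) x - 1 / riemannZeta (1 + t * Complex.I)‖ ≤
        (2 + t ^ 2) / ‖riemannZeta (1 + t * Complex.I)‖ *
            (1 / x * ∫ u in (1 : ℝ)..x, |mobM u|) +
          |mobM x| + 1 / (‖riemannZeta (1 + t * Complex.I)‖ * x ^ 2)) ∧
    -- partial sums on the line `Re s = 1`, for all `x ≥ 2`, with last term `1 / x ^ 2`
    (∀ t : ℝ, t ≠ 0 → ∀ x : ℝ, 2 ≤ x →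
      ‖mobDirichlet (1 + t * Complex.I) x - 1 / riemannZeta (1 + t * Complex.I)‖ ≤
        (2 + t ^ 2) / ‖riemannZeta (1 + t * Complex.I)‖ *
            (1 / x * ∫ u in (1 : ℝ)..x, |mobM u|) +
          |mobM x| + 1 / x ^ 2) := by
  refine ⟨fun ρ hρ x hx => integral_abs_mobM_ge_of_riemannZeta_eq_zero hρ hx,
    fun x hx => integral_abs_mobM_ge_sqrt hx, ?_,
    fun hm s hs => riemannZeta_ne_zero_of_isLittleO_mobM hm hs,
    fun t ht x hx => norm_mobDirichlet_sub_le_of_one_le ht hx,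
    fun t ht x hx => norm_mobDirichlet_sub_le_of_two_le ht hx⟩
  rintro ρ hρ hre ε hε ⟨r, hr, hm⟩
  refine le_abs_im_of_riemannZeta_eq_zero hρ hre hε fun δ hδ => ?_
  have hlim : Tendsto r atTop (𝓝 0) := (Asymptotics.isLittleO_one_iff ℝ).1 hr
  filter_upwards [hm, Metric.tendsto_nhds.1 hlim δ hδ] with x h1 h2
  rw [dist_zero_right, Real.norm_eq_abs] at h2
  have := le_abs_self (r x)
  linarith
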